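/- Let $b\ge 2$ and $s\ge 0$ be integers, and let $\omega_b=e^{2\pi i/b}$. For $k\in\mathbb N=\{0,1,2,\dots\}$ write $k=\kappa_1b^{a_1-1}+\dots+\kappa_vb^{a_v-1}$ with $0<\kappa_i<b$ and $a_1>\dots>a_v\ge 1$ (with $v=0$ for $k=0$), and put $v(k)=v$, $\mu(k)=a_1+\dots+a_v$ (so $\mu(0)=0$). For $x\in[0,1)$ with $b$-adic expansion $x=\sum_{i\ge1}\xi_ib^{-i}$, where infinitely many $\xi_i$ differ from $b-1$, let $\mathrm{wal}_k(x)=\omega_b^{\sum_{i=1}^v\kappa_i\xi_{a_i}}$. For $\boldsymbol k=(k_1,\dots,k_s)\in\mathbb N^s$ let $\mu(\boldsymbol k)=\sum_j\mu(k_j)$, $\mathrm{wal}_{\boldsymbol k}(\boldsymbol x)=\prod_j\mathrm{wal}_{k_j}(x_j)$ and $\widehat f(\boldsymbol k)=\int_{[0,1)^s}f(\boldsymbol x)\,\overline{\mathrm{wal}_{\boldsymbol k}(\boldsymbol x)}\,d\boldsymbol x$. Let $$m_b=\min_{1\le c\le b-1}|1-\overline{\omega_b}^{\,c}|=2\sin(\pi/b),\qquad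 M_b=\max_{1\le c\le b-1}|1-\overline{\omega_b}^{\,c}|=\begin{cases}2&b\text{ even},\\ 2\sin\big(\tfrac{(b+1)\pi}{2b}\big)&b\text{ odd},\end{cases}$$ $$C_b=\begin{cases}2&b=2,\\ M_b+\dfrac{b\,m_b}{b-M_b}&b\ne2.\end{cases}$$ Let $f\colon[0,1]^s\to\mathbb C$ be of class $C^\infty$ on the closed cube, let $r_1,\dots,r_s>0$, and assume that there is a real $D>0$ such that $$\|f^{(n_1,\dots,n_s)}\|_{L^1([0,1)^s)}\le D\prod_{j=1}^s r_j^{n_j}\qquad\text{for all }(n_1,\dots,n_s)\in\mathbb N^s,$$ where $f^{(n_1,\dots,n_s)}=(\partial/\partial x_1)^{n_1}\cdots(\partial/\partial x_s)^{n_s}f$. Then for all $\boldsymbol k\in\mathbb N^s$ $$|\widehat f(\boldsymbol k)|\le D\,b^{-\mu(\boldsymbol k)}\prod_{j=1}^s\left(r_jm_b^{-1}\right)^{v(k_j)}C_b^{\min(1,v(k_j))}.$$ In particular, if $r_j=m_b$ for all $1\le j\le s$, then $\widehat f(\boldsymbol k)=O(b^{-\mu(\boldsymbol k)})$, i.e.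 there is a constant $C$ with $|\widehat f(\boldsymbol k)|\le C\,b^{-\mu(\boldsymbol k)}$ for all $\boldsymbol k\in\mathbb N^s$. -/

import Mathlib

open scoped ContDiff

noncomputable section

namespace WalshDecay

/-- The primitive `b`-th root of unity `exp (2 π i / b)`. -/
def omega (b : ℕ) : ℂ := Complex.exp (2 * Real.pi * Complex.I / b)

/-- The `b`-adic digit of `k` at `b ^ i`, so that `k = ∑ i, natDigit b k i * b ^ i`. -/
def natDigit (b k i : ℕ) : ℕ := (Nat.digits b k).getD i 0

/-- The set `{a_1, …, a_v}` of positions of the nonzero `b`-adic digits of `k`, where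
`k = κ_1 b ^ (a_1 - 1) + ⋯ + κ_v b ^ (a_v - 1)` with `0 < κ_i < b` and `a_1 > ⋯ > a_v ≥ 1`. -/
def positions (b k : ℕ) : Finset ℕ :=
  ((Finset.range (Nat.digits b k).length).filter (fun i => natDigit b k i ≠ 0)).image (· + 1)

/-- The Hamming weight `v(k)`: the number of nonzero `b`-adic digits of `k`. -/
def hammingWeight (b k : ℕ) : ℕ := (positions b k).card

/-- `μ(k) = a_1 + ⋯ + a_v`, and `μ(0) = 0`. -/
def mu (b k : ℕ) : ℕ := ∑ a ∈ positions b k, a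

/-- `μ(k_1, …, k_s) = μ(k_1) + ⋯ + μ(k_s)`. -/
def muVec (b : ℕ) {s : ℕ} (k : Fin s → ℕ) : ℕ := ∑ j, mu b (k j)

/-- The `b`-adic `k`-th Walsh function, used on `[0, 1)`. Here `Real.digits x b i` is the digit
`ξ_{i+1}` of the expansion `x = ξ_1 b⁻¹ + ξ_2 b⁻² + ⋯` that does not end in digits `b - 1`. -/
def wal (b : ℕ) [NeZero b] (k : ℕ) (x : ℝ) : ℂ :=
  omega b ^ (∑ a ∈ positions b k, natDigit b k (a - 1) * (Real.digits x b (a - 1) : ℕ))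

/-- The multivariate Walsh function `wal_{k_1}(x_1) ⋯ wal_{k_s}(x_s)`. -/
def walVec (b : ℕ) [NeZero b] {s : ℕ} (k : Fin s → ℕ) (x : Fin s → ℝ) : ℂ :=
  ∏ j, wal b (k j) (x j)

/-- The half-open unit cube `[0, 1)^s`. -/
def unitCube (s : ℕ) : Set (Fin s → ℝ) := Set.univ.pi (fun _ => Set.Ico (0 : ℝ) 1)

/-- The `k`-th Walsh coefficient of `f`. -/
def walshCoeff (b : ℕ) [NeZero b] {s : ℕ} (f : (Fin s → ℝ) → ℂ) (k : Fin s → ℕ) : ℂ :=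
  ∫ x in unitCube s, f x * starRingEnd ℂ (walVec b k x)

/-- The partial derivative `∂g/∂x_j` on the closed cube `[0, 1]^s` (one-sided on its faces). -/
def partialDeriv {s : ℕ} (j : Fin s) (g : (Fin s → ℝ) → ℂ) : (Fin s → ℝ) → ℂ :=
  fun x => derivWithin (fun t : ℝ => g (Function.update x j t)) (Set.Icc 0 1) (x j)

/-- The mixed derivative `f^{(n_1, …, n_s)} = (∂/∂x_1)^{n_1} ⋯ (∂/∂x_s)^{n_s} f`. -/
def mixedDeriv {s : ℕ} (n : Fin s → ℕ) (f : (Fin s → ℝ) → ℂ) : (Fin s → ℝ) → ℂ :=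
  (List.finRange s).foldr (fun j g => (partialDeriv j)^[n j] g) f

/-- The `L¹` norm on `[0, 1)^s`, with values in `[0, ∞]`. -/
def L1norm {s : ℕ} (g : (Fin s → ℝ) → ℂ) : ENNReal :=
  MeasureTheory.eLpNorm g 1 (MeasureTheory.volume.restrict (unitCube s))

/-- `m_b`: the minimum of `|1 - ω̄^c|` over `c = 1, …, b - 1`. -/
def mConst (b : ℕ) : ℝ :=
  sInf ((fun c : ℕ => ‖1 - starRingEnd ℂ (omega b) ^ c‖) '' Set.Ico 1 b)

/-- `M_b`: the maximum of `|1 - ω̄^c|` over `c = 1, …, b - 1`. -/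
def MConst (b : ℕ) : ℝ :=
  sSup ((fun c : ℕ => ‖1 - starRingEnd ℂ (omega b) ^ c‖) '' Set.Ico 1 b)

/-- The constant `C_b`. -/
def CConst (b : ℕ) : ℝ :=
  if b = 2 then 2 else MConst b + b * mConst b / (b - MConst b)

theorem norm_one_sub_omega_pow {b c : ℕ} (hc : c ∈ Set.Ico 1 b) :
    ‖1 - starRingEnd ℂ (omega b) ^ c‖ = 2 * Real.cos (|Real.pi / 2 - Real.pi * c / b|) := by
  obtain ⟨h1, h2⟩ := hc
  have hb : (0 : ℝ) < b := by exact_mod_cast (by omega : 0 < b)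
  have e : 1 - starRingEnd ℂ (omega b) ^ c
      = starRingEnd ℂ (1 - Complex.exp (Complex.I * ((2 * Real.pi * c / b : ℝ) : ℂ))) := by
    rw [map_sub, map_one, ← map_pow, omega, ← Complex.exp_nat_mul]
    congr 3
    push_cast
    ring
  have hs : 0 ≤ Real.sin (Real.pi * c / b) := by
    apply Real.sin_nonneg_of_nonneg_of_le_pi
    · positivity
    · rw [div_le_iff₀ hb]
      have : (c : ℝ) ≤ b := by exact_mod_cast h2.le
      gcongr
  rw [e, Complex.norm_conj, norm_sub_rev, Complex.norm_exp_I_mul_ofReal_sub_one, Real.cos_abs,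
    Real.cos_pi_div_two_sub, show 2 * Real.pi * c / b / 2 = Real.pi * c / b by ring,
    Real.norm_of_nonneg (by positivity)]

/-- The closed form `m_b = 2 sin (π / b)`. -/
theorem mConst_eq {b : ℕ} (hb : 2 ≤ b) : mConst b = 2 * Real.sin (Real.pi / b) := by
  have hb2 : (2 : ℝ) ≤ b := by exact_mod_cast hb
  have hb0 : (0 : ℝ) < b := by linarith
  have hp := Real.pi_pos
  have h1 : Real.pi / b ≤ Real.pi / 2 := by gcongr
  refine IsLeast.csInf_eq ⟨⟨1, ⟨le_rfl, by omega⟩, ?_⟩, ?_⟩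
  · simp only
    rw [norm_one_sub_omega_pow ⟨le_rfl, by omega⟩, Real.cos_abs, Real.cos_pi_div_two_sub]
    simp
  · rintro _ ⟨c, hc, rfl⟩
    have c1 : (1 : ℝ) ≤ c := by exact_mod_cast hc.1
    have c2 : (c : ℝ) + 1 ≤ b := by exact_mod_cast hc.2
    have e1 : Real.pi / b ≤ Real.pi * c / b := by
      gcongr
      nlinarith
    have e2 : Real.pi * c / b ≤ Real.pi - Real.pi / b := by
      rw [le_sub_iff_add_le, ← add_div, div_le_iff₀ hb0]
      nlinarith
    simp only
    rw [norm_one_sub_omega_pow hc, ← Real.cos_pi_div_two_sub]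
    have : |Real.pi / 2 - Real.pi * c / b| ≤ Real.pi / 2 - Real.pi / b := by
      rw [abs_le]
      constructor <;> linarith
    have h3 : 0 < Real.pi / b := by positivity
    have := Real.cos_le_cos_of_nonneg_of_le_pi (abs_nonneg _) (by linarith) this
    linarith

/-- The closed form of `M_b`. -/
theorem MConst_eq {b : ℕ} (hb : 2 ≤ b) :
    MConst b = if Even b then 2 else 2 * Real.sin ((b + 1) * Real.pi / (2 * b)) := by
  have hb2 : (2 : ℝ) ≤ b := by exact_mod_cast hb
  have hb0 : (0 : ℝ) < b := by linarith
  have hp := Real.pi_pos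
  split_ifs with he
  · obtain ⟨d, hd⟩ := he
    have hdb : (b : ℝ) = d + d := by exact_mod_cast hd
    refine IsGreatest.csSup_eq ⟨⟨d, ⟨by omega, by omega⟩, ?_⟩, ?_⟩
    · simp only
      rw [norm_one_sub_omega_pow ⟨by omega, by omega⟩, hdb]
      have hd0 : (d : ℝ) ≠ 0 := by
        intro h
        rw [h] at hdb
        linarith
      have : Real.pi / 2 - Real.pi * d / (d + d) = 0 := by
        field_simp
        ring
      rw [this]
      simp
    · rintro _ ⟨c, hc, rfl⟩
      simp only
      rw [norm_one_sub_omega_pow hc]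
      linarith [Real.cos_le_one |Real.pi / 2 - Real.pi * c / b|]
  · obtain ⟨d, hd⟩ := Nat.not_even_iff_odd.1 he
    have hdb : (b : ℝ) = 2 * d + 1 := by exact_mod_cast hd
    refine IsGreatest.csSup_eq ⟨⟨d + 1, ⟨by omega, by omega⟩, ?_⟩, ?_⟩
    · simp only
      rw [norm_one_sub_omega_pow ⟨by omega, by omega⟩, Real.cos_abs, Real.cos_pi_div_two_sub]
      congr 2
      push_cast
      rw [hdb]
      field_simp
      ring
    · rintro _ ⟨c, hc, rfl⟩
      simp only
      rw [norm_one_sub_omega_pow hc, ← Real.cos_sub_pi_div_two]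
      have e0 : (b + 1) * Real.pi / (2 * b) - Real.pi / 2 = Real.pi / (2 * b) := by
        field_simp
        ring
      have e1 : Real.pi / 2 - Real.pi * c / b = Real.pi / (2 * b) * (b - 2 * c) := by
        field_simp
      have e2 : (1 : ℝ) ≤ |(b : ℝ) - 2 * c| := by
        have : (1 : ℤ) ≤ |(b : ℤ) - 2 * c| := by
          apply Int.one_le_abs
          omega
        exact_mod_cast this
      have c1 : (1 : ℝ) ≤ c := by exact_mod_cast hc.1
      have c2 : (c : ℝ) + 1 ≤ b := by exact_mod_cast hc.2
      have q : 0 < Real.pi / (2 * b) := by positivity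
      have e3 : Real.pi / (2 * b) * b = Real.pi / 2 := by field_simp
      have e4 : |(b : ℝ) - 2 * c| ≤ b := by
        rw [abs_le]
        constructor <;> linarith
      rw [e0, e1, abs_mul, abs_of_pos q]
      have := Real.cos_le_cos_of_nonneg_of_le_pi (x := Real.pi / (2 * b))
        (y := Real.pi / (2 * b) * |(b : ℝ) - 2 * c|) q.le (by nlinarith) (by nlinarith)
      linarith

end WalshDecay

end

/-!
The complex conjugate of `wal_k` is a product of step characters `x ↦ z ^ ⌊bᵃ x⌋`, one for each
position `a` of a nonzero digit of `k`. Integrate `f` times this product by parts once for each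
digit, starting with the finest one. Each iterated primitive is periodic with the period of the next
coarser digit and vanishes at its multiples, hence at all the jumps of the remaining characters and
at `0` and `1`: no boundary terms occur, and the coefficient becomes the integral of the `v(k)`-th
derivative against a kernel.

Taking a primitive multiplies the mean by `b⁻ᵃ / (1 - z)`, which accounts for a factor
`b⁻ᵃ m_b⁻¹` per digit. The sup norm differs from the mean only by the constant `C_b`, once and for
all: for `b = 2` the kernels are, up to sign, nonnegative and bounded by an integral over one
period. For `b ≥ 3` the law `F (x + p) = F p + z F x` reduces the estimate to one period, where the
primitive differs from its chord by the primitive of `W - mean W`, and the latter is bounded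
recursively along the digits. In several variables this is done one coordinate at a time by Fubini.
-/

noncomputable section

namespace WalshDecay

open MeasureTheory Set Function Filter Topology

/-! ### Functions with an affine translation law -/

theorem apply_add_zsmul_of_affine {G K : Type*} [AddCommGroup G] [Field K] {F : G → K} {p : G}
    {z J : K} (hz : z ≠ 0) (hz1 : z ≠ 1) (hF : ∀ x, F (x + p) = J + z * F x) (c : ℤ) (x : G) :
    F (x + c • p) = J / (1 - z) * (1 - z ^ c) + z ^ c * F x := by
  have h1 : 1 - z ≠ 0 := sub_ne_zero.2 hz1.symm
  induction c with
  | zero => simp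
  | succ n ih =>
    rw [add_zsmul, one_zsmul, ← add_assoc, hF, ih, zpow_add_one₀ hz]
    field_simp
    ring
  | pred n ih =>
    have h := hF (x + (-(n : ℤ) - 1) • p)
    rw [sub_zsmul, one_zsmul, add_assoc, neg_add_cancel_right, ih] at h
    rw [sub_zsmul, one_zsmul, zpow_sub_one₀ hz]
    apply mul_left_cancel₀ hz
    rw [← sub_eq_iff_eq_add'.2 h]
    field_simp
    ring

theorem periodic_of_affine {G K : Type*} [AddCommGroup G] [Field K] {F : G → K} {p : G} {z J : K}
    {b : ℕ} (hb : b ≠ 0) (hzb : z ^ b = 1) (hz1 : z ≠ 1) (hF : ∀ x, F (x + p) = J + z * F x) :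
    Periodic F (b • p) := by
  intro x
  have hz : z ≠ 0 := by
    rintro rfl
    simp [hb] at hzb
  simpa [hzb] using apply_add_zsmul_of_affine hz hz1 hF b x

theorem norm_le_of_affine {F : ℝ → ℂ} {p M δ : ℝ} {z : ℂ} (hp : 0 < p) (hz : ‖z‖ = 1)
    (hz1 : z ≠ 1) (hF : ∀ x, F (x + p) = F p + z * F x) (hM : ∀ c : ℤ, ‖1 - z ^ c‖ ≤ M)
    (hδ : ∀ u ∈ Icc 0 p, ‖F u - (u / p : ℝ) * F p‖ ≤ δ) (x : ℝ) :
    ‖F x‖ ≤ ‖F p‖ / ‖1 - z‖ * M + δ := by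
  have hz0 : z ≠ 0 := norm_ne_zero_iff.1 (hz ▸ one_ne_zero)
  have h1 : 1 - z ≠ 0 := sub_ne_zero.2 hz1.symm
  obtain ⟨c, u, hu, rfl⟩ : ∃ (c : ℤ) (u : ℝ), u ∈ Ico 0 p ∧ u + c • p = x :=
    ⟨toIcoDiv hp 0 x, _, by simpa using toIcoMod_mem_Ico hp 0 x,
      toIcoMod_add_toIcoDiv_zsmul hp 0 x⟩
  have ht0 : 0 ≤ u / p := div_nonneg hu.1 hp.le
  have ht1 : u / p ≤ 1 := (div_le_one hp).2 hu.2.le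
  have split : F (u + c • p) = F p / (1 - z) * (((1 - u / p : ℝ) : ℂ) * (1 - z ^ c)
      + ((u / p : ℝ) : ℂ) * (1 - z ^ (c + 1))) + z ^ c * (F u - (u / p : ℝ) * F p) := by
    rw [apply_add_zsmul_of_affine hz0 hz1 hF, zpow_add_one₀ hz0]
    push_cast
    field_simp
    ring
  rw [split]
  refine (norm_add_le _ _).trans (add_le_add ?_ ?_)
  · rw [norm_mul, norm_div]
    gcongr
    refine (norm_add_le _ _).trans ?_
    rw [norm_mul, norm_mul, Complex.norm_real, Complex.norm_real, Real.norm_of_nonneg ht0,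
      Real.norm_of_nonneg (by linarith)]
    nlinarith [hM c, hM (c + 1)]
  · rw [norm_mul, norm_zpow, hz, one_zpow, one_mul]
    exact hδ u ⟨hu.1, hu.2.le⟩

theorem integral_add_of_translate {h : ℝ → ℂ} {p : ℝ} {z : ℂ}
    (hi : ∀ a b, IntervalIntegrable h volume a b) (ht : ∀ x, h (x + p) = z * h x) (x : ℝ) :
    ∫ t in 0..(x + p), h t = (∫ t in 0..p, h t) + z * ∫ t in 0..x, h t := by
  rw [← intervalIntegral.integral_add_adjacent_intervals (hi 0 p) (hi p (x + p)),
    ← intervalIntegral.integral_const_mul]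
  simp_rw [← ht]
  rw [intervalIntegral.integral_comp_add_right, zero_add]

theorem norm_integral_sub_chord_le {E : Type*} [NormedAddCommGroup E] [NormedSpace ℝ E]
    {h : ℝ → E} {p ε u : ℝ} (hp : 0 < p) (hi : ∀ a b, IntervalIntegrable h volume a b)
    (hε : ∀ x, ‖h x‖ ≤ ε) (hu : u ∈ Icc 0 p) :
    ‖(∫ t in 0..u, h t) - (u / p) • ∫ t in 0..p, h t‖ ≤ p * ε / 2 := by
  have hε0 : 0 ≤ ε := (norm_nonneg _).trans (hε 0)
  have ht0 : 0 ≤ u / p := div_nonneg hu.1 hp.le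
  have ht1 : 0 ≤ 1 - u / p := sub_nonneg.2 ((div_le_one hp).2 hu.2)
  have bound {a c : ℝ} (hac : a ≤ c) : ‖∫ t in a..c, h t‖ ≤ ε * (c - a) := by
    simpa [abs_of_nonneg (sub_nonneg.2 hac)] using
      intervalIntegral.norm_integral_le_of_norm_le_const (a := a) (b := c) fun t _ => hε t
  have split : (∫ t in 0..u, h t) - (u / p) • ∫ t in 0..p, h t
      = (1 - u / p) • (∫ t in 0..u, h t) - (u / p) • ∫ t in u..p, h t := by
    rw [← intervalIntegral.integral_add_adjacent_intervals (hi 0 u) (hi u p)]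
    module
  calc ‖(∫ t in 0..u, h t) - (u / p) • ∫ t in 0..p, h t‖
      ≤ (1 - u / p) * ‖∫ t in 0..u, h t‖ + u / p * ‖∫ t in u..p, h t‖ := by
        rw [split]
        refine (norm_sub_le _ _).trans_eq ?_
        rw [norm_smul, norm_smul, Real.norm_of_nonneg ht0, Real.norm_of_nonneg ht1]
    _ ≤ (1 - u / p) * (ε * (u - 0)) + u / p * (ε * (p - u)) := by
        gcongr
        exacts [bound hu.1, bound hu.2]
    _ = p * ε * (2 * (u / p) * (1 - u / p)) := by
        field_simp
        ring
    _ ≤ p * ε * (1 / 2) := by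
        gcongr
        nlinarith [sq_nonneg (u / p - 1 / 2)]
    _ = p * ε / 2 := by ring

/-! ### Roots of unity and the constants `m_b` and `M_b` -/

/-- `z` is a `b`-th root of unity other than `1`. -/
structure IsNontrivialRoot (b : ℕ) (z : ℂ) : Prop where
  ne_zero : b ≠ 0
  pow_eq_one : z ^ b = 1
  ne_one : z ≠ 1

theorem isPrimitiveRoot_conj_omega {b : ℕ} (hb : b ≠ 0) :
    IsPrimitiveRoot (starRingEnd ℂ (omega b)) b :=
  (Complex.isPrimitiveRoot_exp b hb).map_of_injective (starRingEnd ℂ).injective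

theorem MConst_nonneg (b : ℕ) : 0 ≤ MConst b :=
  Real.sSup_nonneg (by rintro _ ⟨c, -, rfl⟩; exact norm_nonneg _)

theorem MConst_le_two (b : ℕ) : MConst b ≤ 2 := by
  refine Real.sSup_le ?_ zero_le_two
  rintro _ ⟨c, hc, rfl⟩
  beta_reduce
  rw [norm_one_sub_omega_pow hc]
  linarith [Real.cos_le_one |Real.pi / 2 - Real.pi * c / b|]

theorem sub_MConst_pos {b : ℕ} (hb : 3 ≤ b) : 0 < b - MConst b := by
  have hb' : (3 : ℝ) ≤ b := by exact_mod_cast hb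
  linarith [MConst_le_two b]

theorem four_div_le_mConst {b : ℕ} (hb : 2 ≤ b) : 4 / b ≤ mConst b := by
  have hb' : (2 : ℝ) ≤ b := by exact_mod_cast hb
  have h := Real.mul_le_sin (x := Real.pi / b) (by positivity) (by gcongr)
  rw [mConst_eq hb]
  calc (4 : ℝ) / b = 2 * (2 / Real.pi * (Real.pi / b)) := by field_simp; norm_num
    _ ≤ 2 * Real.sin (Real.pi / b) := by gcongr

theorem mConst_pos {b : ℕ} (hb : 2 ≤ b) : 0 < mConst b := by
  have : (0 : ℝ) < b := by exact_mod_cast (by omega : 0 < b)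
  exact (by positivity : 0 < 4 / (b : ℝ)).trans_le (four_div_le_mConst hb)

theorem mConst_two : mConst 2 = 2 := by
  rw [mConst_eq le_rfl, Nat.cast_ofNat, Real.sin_pi_div_two, mul_one]

theorem mConst_three : mConst 3 = √3 := by
  rw [mConst_eq (by norm_num), Nat.cast_ofNat, Real.sin_pi_div_three]
  ring

theorem MConst_three : MConst 3 = √3 := by
  rw [MConst_eq (by norm_num), if_neg (by decide), Nat.cast_ofNat,
    show ((3 : ℝ) + 1) * Real.pi / (2 * 3) = Real.pi - Real.pi / 3 by ring, Real.sin_pi_sub,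
    Real.sin_pi_div_three]
  ring

theorem CConst_nonneg {b : ℕ} (hb : 2 ≤ b) : 0 ≤ CConst b := by
  unfold CConst
  split_ifs with h
  · exact zero_le_two
  · have hM := MConst_nonneg b
    have hm := mConst_pos hb
    have hbM := sub_MConst_pos (show 3 ≤ b by omega)
    positivity

namespace IsNontrivialRoot

variable {b : ℕ} {z : ℂ}

theorem norm_eq_one (hz : IsNontrivialRoot b z) : ‖z‖ = 1 :=
  Complex.norm_eq_one_of_pow_eq_one hz.pow_eq_one hz.ne_zero

theorem exists_mem_Ico (hz : IsNontrivialRoot b z) :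
    ∃ c ∈ Ico 1 b, starRingEnd ℂ (omega b) ^ c = z := by
  have := NeZero.mk hz.ne_zero
  obtain ⟨c, hc, rfl⟩ :=
    (isPrimitiveRoot_conj_omega hz.ne_zero).eq_pow_of_pow_eq_one hz.pow_eq_one
  refine ⟨c, ⟨Nat.one_le_iff_ne_zero.2 ?_, hc⟩, rfl⟩
  rintro rfl
  exact hz.ne_one (pow_zero _)

theorem mConst_le (hz : IsNontrivialRoot b z) : mConst b ≤ ‖1 - z‖ := by
  obtain ⟨c, hc, rfl⟩ := hz.exists_mem_Ico
  exact csInf_le ((finite_Ico 1 b).image _).bddBelow (mem_image_of_mem _ hc)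

theorem le_MConst (hz : IsNontrivialRoot b z) : ‖1 - z‖ ≤ MConst b := by
  obtain ⟨c, hc, rfl⟩ := hz.exists_mem_Ico
  exact le_csSup ((finite_Ico 1 b).image _).bddAbove (mem_image_of_mem _ hc)

theorem norm_one_sub_zpow_le_MConst (hz : IsNontrivialRoot b z) (c : ℤ) :
    ‖1 - z ^ c‖ ≤ MConst b := by
  by_cases h : z ^ c = 1
  · rw [h, sub_self, norm_zero]
    exact MConst_nonneg b
  · refine le_MConst ⟨hz.ne_zero, ?_, h⟩
    rw [← zpow_natCast, ← zpow_mul, mul_comm, zpow_mul, zpow_natCast, hz.pow_eq_one, one_zpow]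

theorem eq_neg_one (hz : IsNontrivialRoot 2 z) : z = -1 :=
  (sq_eq_one_iff.1 hz.pow_eq_one).resolve_left hz.ne_one

theorem norm_one_sub_three (hz : IsNontrivialRoot 3 z) : ‖1 - z‖ = √3 :=
  le_antisymm (MConst_three ▸ hz.le_MConst) (mConst_three ▸ hz.mConst_le)

theorem norm_one_add_sq (hz : IsNontrivialRoot b z) : ‖1 + z‖ ^ 2 = 4 - ‖1 - z‖ ^ 2 := by
  have h := parallelogram_law_with_norm ℝ 1 z
  rw [hz.norm_eq_one, norm_one] at h
  linarith

end IsNontrivialRoot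

/-- The constant `b / (b - M_b)` in the sup bound for `meanDeviation` of an iterated Walsh
primitive: the fixed point `B = 1 + B M_b / b` of the recursion met at each further primitive. -/
def deviationConst (b : ℕ) : ℝ := b / (b - MConst b)

theorem deviationConst_nonneg {b : ℕ} (hb : 3 ≤ b) : 0 ≤ deviationConst b :=
  div_nonneg (Nat.cast_nonneg b) (sub_MConst_pos hb).le

theorem deviationConst_mul {b : ℕ} (hb : 3 ≤ b) : deviationConst b * (b - MConst b) = b :=
  div_mul_cancel₀ _ (sub_MConst_pos hb).ne'

theorem deviationConst_le_two {b : ℕ} (hb : 4 ≤ b) : deviationConst b ≤ 2 := by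
  have hb' : (4 : ℝ) ≤ b := by exact_mod_cast hb
  rw [deviationConst, div_le_iff₀ (sub_MConst_pos (by omega))]
  linarith [MConst_le_two b]

theorem IsNontrivialRoot.linear_deviation_le_of_three {z : ℂ} (hz : IsNontrivialRoot 3 z) :
    ‖1 + z‖ * MConst 3 / (2 * ‖1 - z‖) + ‖1 - z‖ / 8 + deviationConst 3 * (‖1 - z‖ / 2) ≤ 3 := by
  have hsq : √3 ^ 2 = 3 := Real.sq_sqrt (by norm_num)
  have hle : √3 ≤ 9 / 5 := Real.sqrt_le_iff.2 ⟨by norm_num, by norm_num⟩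
  have hadd : ‖1 + z‖ = 1 := by
    have h := hz.norm_one_add_sq
    rw [hz.norm_one_sub_three, hsq] at h
    exact (sq_eq_sq₀ (norm_nonneg _) zero_le_one).1 (by linarith)
  have hdev : deviationConst 3 ≤ 5 / 2 := by
    rw [deviationConst, MConst_three, Nat.cast_ofNat, div_le_iff₀ (by linarith)]
    linarith
  rw [hadd, hz.norm_one_sub_three, MConst_three,
    show 1 * √3 / (2 * √3) = 1 / 2 by field_simp]
  nlinarith [Real.sqrt_nonneg 3]

theorem IsNontrivialRoot.linear_deviation_le_of_four_le {b : ℕ} (hb : 4 ≤ b) {z : ℂ}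
    (hz : IsNontrivialRoot b z) :
    ‖1 + z‖ * MConst b / (2 * ‖1 - z‖) + ‖1 - z‖ / 8 + deviationConst b * (‖1 - z‖ / 2) ≤ b := by
  have hb' : (4 : ℝ) ≤ b := by exact_mod_cast hb
  have hd : 4 / b ≤ ‖1 - z‖ := (four_div_le_mConst (by omega)).trans hz.mConst_le
  have hd0 : 0 < ‖1 - z‖ := (by positivity : 0 < 4 / (b : ℝ)).trans_le hd
  have hsum : ‖1 + z‖ + ‖1 - z‖ ≤ 3 := by
    nlinarith [hz.norm_one_add_sq, sq_nonneg (‖1 + z‖ - ‖1 - z‖)]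
  have hquot : ‖1 + z‖ * MConst b / (2 * ‖1 - z‖) ≤ b / 4 * ‖1 + z‖ :=
    calc ‖1 + z‖ * MConst b / (2 * ‖1 - z‖) ≤ ‖1 + z‖ * 2 / (2 * (4 / b)) := by
          gcongr
          exact MConst_le_two b
      _ = b / 4 * ‖1 + z‖ := by field_simp
  nlinarith [deviationConst_le_two hb, norm_nonneg (1 + z)]

theorem IsNontrivialRoot.deviation_le {b : ℕ} (hb : 3 ≤ b) {z : ℂ} (hz : IsNontrivialRoot b z) :
    ‖1 + z‖ * MConst b / (2 * ‖1 - z‖) + ‖1 - z‖ / 8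
      + deviationConst b * (MConst b + ‖1 - z‖ / 2) ≤ b * deviationConst b := by
  have h : ‖1 + z‖ * MConst b / (2 * ‖1 - z‖) + ‖1 - z‖ / 8 + deviationConst b * (‖1 - z‖ / 2)
      ≤ b := by
    rcases hb.eq_or_lt with rfl | h4
    · exact_mod_cast hz.linear_deviation_le_of_three
    · exact hz.linear_deviation_le_of_four_le h4
  linarith [deviationConst_mul hb]

/-! ### Step characters and their primitives -/

/-- The step function with value `z ^ n` on `[n p, (n + 1) p)`. For a `b`-th root of unity `z` and
`p = b⁻ᵃ` it depends only on the `a`-th digit of `x`. -/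
def stepChar (z : ℂ) (p x : ℝ) : ℂ := z ^ ⌊x / p⌋

section stepChar

variable {z : ℂ} {p : ℝ}

theorem norm_stepChar (hz : ‖z‖ = 1) (p x : ℝ) : ‖stepChar z p x‖ = 1 := by
  rw [stepChar, norm_zpow, hz, one_zpow]

theorem measurable_stepChar (z : ℂ) (p : ℝ) : Measurable (stepChar z p) :=
  (measurable_from_top (f := fun n : ℤ => z ^ n)).comp (measurable_id.div_const p).floor

theorem stepChar_add (hz : z ≠ 0) (hp : p ≠ 0) (x : ℝ) :
    stepChar z p (x + p) = z * stepChar z p x := by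
  rw [stepChar, stepChar, add_div, div_self hp, Int.floor_add_one, zpow_add_one₀ hz, mul_comm]

theorem stepChar_of_mem_Ico {x : ℝ} (hx : x ∈ Ico 0 p) : stepChar z p x = 1 := by
  have hp : 0 < p := hx.1.trans_lt hx.2
  have h : ⌊x / p⌋ = 0 := Int.floor_eq_zero_iff.2 ⟨div_nonneg hx.1 hp.le, (div_lt_one hp).2 hx.2⟩
  rw [stepChar, h, zpow_zero]

theorem stepChar_eventuallyEq_nhdsGE (z : ℂ) (hp : 0 < p) (x : ℝ) :
    ∀ᶠ y in 𝓝[≥] x, stepChar z p y = stepChar z p x := by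
  have h : Tendsto (· / p) (𝓝[≥] x) (𝓝[≥] (x / p)) :=
    ((continuous_id.div_const p).continuousWithinAt).tendsto_nhdsWithin
      fun y hy => div_le_div_of_nonneg_right hy hp.le
  filter_upwards [tendsto_pure.1 ((tendsto_floor_right_pure_floor (x / p)).comp h)] with y hy
  exact congrArg (z ^ ·) hy

theorem stepChar_eventuallyEq_nhds (z : ℂ) {x : ℝ} (hx : ∀ n : ℤ, x / p ≠ n) :
    ∀ᶠ y in 𝓝 x, stepChar z p y = stepChar z p x := by
  have h : Ioo (⌊x / p⌋ : ℝ) (⌊x / p⌋ + 1) ∈ 𝓝 (x / p) :=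
    Ioo_mem_nhds ((Int.floor_le _).lt_of_ne (hx _).symm) (Int.lt_floor_add_one _)
  filter_upwards [(continuous_id.div_const p).continuousAt.preimage_mem_nhds h] with y hy
  exact congrArg (z ^ ·) (Int.floor_eq_iff.2 ⟨hy.1.le, hy.2⟩)

end stepChar

/-- `W` is a continuous `p`-periodic function with mean value `l`. -/
structure IsPeriodicWithMean (W : ℝ → ℂ) (p : ℝ) (l : ℂ) : Prop where
  continuous : Continuous W
  periodic : Periodic W p
  integral_eq : ∫ t in 0..p, W t = p * l

/-- The primitive of `W` times a step character that vanishes at `0`. -/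
def charPrimitive (z : ℂ) (p : ℝ) (W : ℝ → ℂ) (x : ℝ) : ℂ := ∫ t in 0..x, stepChar z p t * W t

/-- The primitive of `W - l` that vanishes at `0`. It is periodic when `l` is the mean of `W`. -/
def meanDeviation (W : ℝ → ℂ) (l : ℂ) (x : ℝ) : ℂ := ∫ t in 0..x, (W t - l)

section charPrimitive

variable {z l : ℂ} {p M ε : ℝ} {W : ℝ → ℂ}

theorem intervalIntegrable_stepChar_mul (hz : ‖z‖ = 1) (p : ℝ) (hW : Continuous W) (a b : ℝ) :
    IntervalIntegrable (fun t => stepChar z p t * W t) volume a b := by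
  rw [intervalIntegrable_iff]
  exact (hW.intervalIntegrable a b).def'.bdd_mul (c := 1)
    (measurable_stepChar z p).aestronglyMeasurable (.of_forall fun x => (norm_stepChar hz p x).le)

theorem charPrimitive_zero : charPrimitive z p W 0 = 0 := intervalIntegral.integral_same

theorem charPrimitive_of_mem_Icc {u : ℝ} (hu : u ∈ Icc 0 p) :
    charPrimitive z p W u = ∫ t in 0..u, W t := by
  refine intervalIntegral.integral_congr_Ioo_of_le hu.1 fun t ht => ?_
  rw [stepChar_of_mem_Ico ⟨ht.1.le, ht.2.trans_le hu.2⟩, one_mul]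

theorem charPrimitive_add (hz : ‖z‖ = 1) (hp : 0 < p) (hW : Continuous W)
    (hper : Periodic W p) (x : ℝ) :
    charPrimitive z p W (x + p) = charPrimitive z p W p + z * charPrimitive z p W x := by
  refine integral_add_of_translate (intervalIntegrable_stepChar_mul hz p hW) (fun y => ?_) x
  rw [stepChar_add (norm_ne_zero_iff.1 (hz ▸ one_ne_zero)) hp.ne', hper, mul_assoc]

theorem continuous_charPrimitive (hz : ‖z‖ = 1) (p : ℝ) (hW : Continuous W) :
    Continuous (charPrimitive z p W) :=
  intervalIntegral.continuous_primitive (intervalIntegrable_stepChar_mul hz p hW) 0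

theorem hasDerivWithinAt_charPrimitive (hz : ‖z‖ = 1) (hp : 0 < p) (hW : Continuous W) (x : ℝ) :
    HasDerivWithinAt (charPrimitive z p W) (stepChar z p x * W x) (Ioi x) x := by
  have hmeas := ((measurable_stepChar z p).mul hW.measurable).stronglyMeasurable
  refine (intervalIntegral.integral_hasDerivWithinAt_right
    (intervalIntegrable_stepChar_mul hz p hW 0 x) (s := Ici x) (t := Ioi x)
    hmeas.stronglyMeasurableAtFilter ?_).mono Ioi_subset_Ici_self
  have hstep : ContinuousWithinAt (stepChar z p) (Ici x) x :=
    continuousWithinAt_const.congr_of_eventuallyEq (stepChar_eventuallyEq_nhdsGE z hp x) rfl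
  exact (hstep.mul hW.continuousWithinAt).mono Ioi_subset_Ici_self

theorem meanDeviation_eq_sub (hW : Continuous W) (l : ℂ) (x : ℝ) :
    meanDeviation W l x = (∫ t in 0..x, W t) - x * l := by
  rw [meanDeviation, intervalIntegral.integral_sub (hW.intervalIntegrable _ _) (by simp),
    intervalIntegral.integral_const, sub_zero, Complex.real_smul]

theorem continuous_meanDeviation (hW : Continuous W) (l : ℂ) : Continuous (meanDeviation W l) :=
  intervalIntegral.continuous_primitive
    (fun a b => (hW.sub continuous_const).intervalIntegrable a b) 0

namespace IsPeriodicWithMean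

theorem charPrimitive_eq (hW : IsPeriodicWithMean W p l) (hp : 0 ≤ p) :
    charPrimitive z p W p = p * l := by
  rw [charPrimitive_of_mem_Icc (right_mem_Icc.2 hp), hW.integral_eq]

theorem nsmul (hW : IsPeriodicWithMean W p l) (n : ℕ) : IsPeriodicWithMean W (n • p) l := by
  refine ⟨hW.continuous, hW.periodic.nsmul n, ?_⟩
  have h := hW.periodic.intervalIntegral_add_zsmul_eq n 0
    (hW.continuous.intervalIntegrable (μ := volume))
  rw [zero_add, zero_add, hW.integral_eq, natCast_zsmul] at h
  rw [h]
  simp [mul_assoc]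

theorem meanDeviation_charPrimitive_add (hW : IsPeriodicWithMean W p l) (hp : 0 < p)
    (hz : ‖z‖ = 1) (hz1 : z ≠ 1) (x : ℝ) :
    meanDeviation (charPrimitive z p W) (p * l / (1 - z)) (x + p)
      = meanDeviation (charPrimitive z p W) (p * l / (1 - z)) p
        + z * meanDeviation (charPrimitive z p W) (p * l / (1 - z)) x := by
  have h1 : 1 - z ≠ 0 := sub_ne_zero.2 hz1.symm
  have hc := (continuous_charPrimitive hz p hW.continuous).sub
    (continuous_const (y := p * l / (1 - z)))
  refine integral_add_of_translate (fun a b => hc.intervalIntegrable a b) (fun y => ?_) x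
  rw [Pi.sub_apply, Pi.sub_apply, charPrimitive_add hz hp hW.continuous hW.periodic,
    hW.charPrimitive_eq hp.le]
  field_simp
  ring

protected theorem charPrimitive {b : ℕ} (hW : IsPeriodicWithMean W p l) (hp : 0 < p)
    (hz : IsNontrivialRoot b z) :
    IsPeriodicWithMean (charPrimitive z p W) (b • p) (p * l / (1 - z)) := by
  have hc := continuous_charPrimitive hz.norm_eq_one p hW.continuous
  refine ⟨hc, periodic_of_affine hz.ne_zero hz.pow_eq_one hz.ne_one
    (charPrimitive_add hz.norm_eq_one hp hW.continuous hW.periodic), ?_⟩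
  have h := periodic_of_affine hz.ne_zero hz.pow_eq_one hz.ne_one
    (hW.meanDeviation_charPrimitive_add hp hz.norm_eq_one hz.ne_one) 0
  rw [zero_add, meanDeviation_eq_sub hc, meanDeviation_eq_sub hc] at h
  simpa [sub_eq_zero] using h

theorem norm_charPrimitive_le (hW : IsPeriodicWithMean W p l) (hp : 0 < p) (hz : ‖z‖ = 1)
    (hz1 : z ≠ 1) (hM : ∀ c : ℤ, ‖1 - z ^ c‖ ≤ M) (hε : ∀ x, ‖meanDeviation W l x‖ ≤ ε) (x : ℝ) :
    ‖charPrimitive z p W x‖ ≤ ‖p * l / (1 - z)‖ * M + ε := by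
  rw [norm_div, ← hW.charPrimitive_eq (z := z) hp.le]
  refine norm_le_of_affine hp hz hz1 (charPrimitive_add hz hp hW.continuous hW.periodic) hM ?_ x
  intro u hu
  have hp' : (p : ℂ) ≠ 0 := by exact_mod_cast hp.ne'
  convert hε u using 2
  rw [meanDeviation_eq_sub hW.continuous, charPrimitive_of_mem_Icc hu, hW.charPrimitive_eq hp.le]
  push_cast
  field_simp

theorem meanDeviation_charPrimitive_of_mem_Icc (hW : IsPeriodicWithMean W p l)
    (hz : ‖z‖ = 1) (l' : ℂ) {u : ℝ} (hu : u ∈ Icc 0 p) :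
    meanDeviation (charPrimitive z p W) l' u
      = u ^ 2 / 2 * l - u * l' + ∫ t in 0..u, meanDeviation W l t := by
  have hd := continuous_meanDeviation hW.continuous l
  rw [meanDeviation_eq_sub (continuous_charPrimitive hz p hW.continuous),
    intervalIntegral.integral_congr (g := fun t : ℝ => t * l + meanDeviation W l t) fun t ht => ?_]
  · rw [intervalIntegral.integral_add (Continuous.intervalIntegrable (by fun_prop) _ _)
      (hd.intervalIntegrable _ _), intervalIntegral.integral_mul_const,
      intervalIntegral.integral_ofReal, integral_id]
    push_cast
    ring
  · rw [uIcc_of_le hu.1] at ht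
    beta_reduce
    rw [charPrimitive_of_mem_Icc ⟨ht.1, ht.2.trans hu.2⟩, meanDeviation_eq_sub hW.continuous]
    ring

theorem norm_meanDeviation_charPrimitive_period_le (hW : IsPeriodicWithMean W p l) (hp : 0 < p)
    (hz : ‖z‖ = 1) (hz1 : z ≠ 1) (hε : ∀ x, ‖meanDeviation W l x‖ ≤ ε) :
    ‖meanDeviation (charPrimitive z p W) (p * l / (1 - z)) p‖
      ≤ p * ‖p * l / (1 - z)‖ * (‖1 + z‖ / 2) + p * ε := by
  have h1 : 1 - z ≠ 0 := sub_ne_zero.2 hz1.symm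
  have main_term : (p : ℂ) ^ 2 / 2 * l - p * (p * l / (1 - z))
      = -(p * (p * l / (1 - z)) * ((1 + z) / 2)) := by
    field_simp
    ring
  rw [hW.meanDeviation_charPrimitive_of_mem_Icc hz _ (right_mem_Icc.2 hp.le), main_term]
  refine (norm_add_le _ _).trans (add_le_add (le_of_eq ?_) ?_)
  · rw [norm_neg, norm_mul, norm_mul, Complex.norm_real, Real.norm_of_nonneg hp.le,
      norm_div (1 + z), Complex.norm_ofNat]
  · simpa [abs_of_pos hp, mul_comm] using
      intervalIntegral.norm_integral_le_of_norm_le_const (a := 0) (b := p) fun t _ => hε t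

theorem norm_meanDeviation_charPrimitive_sub_chord_le (hW : IsPeriodicWithMean W p l) (hp : 0 < p)
    (hz : ‖z‖ = 1) (hz1 : z ≠ 1) (hε : ∀ x, ‖meanDeviation W l x‖ ≤ ε) {u : ℝ} (hu : u ∈ Icc 0 p) :
    ‖meanDeviation (charPrimitive z p W) (p * l / (1 - z)) u
        - (u / p : ℝ) * meanDeviation (charPrimitive z p W) (p * l / (1 - z)) p‖
      ≤ p * ‖p * l / (1 - z)‖ * (‖1 - z‖ / 8) + p * ε / 2 := by
  have h1 : 1 - z ≠ 0 := sub_ne_zero.2 hz1.symm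
  have hp' : (p : ℂ) ≠ 0 := by exact_mod_cast hp.ne'
  have hd := continuous_meanDeviation hW.continuous l
  have hquad : ‖u * (u - p) / 2 / p‖ ≤ p / 8 := by
    rw [Real.norm_eq_abs, abs_le, le_div_iff₀ hp, div_le_iff₀ hp]
    constructor <;> nlinarith [hu.1, hu.2, sq_nonneg (u - p / 2)]
  have split : meanDeviation (charPrimitive z p W) (p * l / (1 - z)) u
      - (u / p : ℝ) * meanDeviation (charPrimitive z p W) (p * l / (1 - z)) p
      = ((u * (u - p) / 2 / p : ℝ) : ℂ) * (p * l / (1 - z) * (1 - z))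
        + ((∫ t in 0..u, meanDeviation W l t) - (u / p) • ∫ t in 0..p, meanDeviation W l t) := by
    rw [hW.meanDeviation_charPrimitive_of_mem_Icc hz _ hu,
      hW.meanDeviation_charPrimitive_of_mem_Icc hz _ (right_mem_Icc.2 hp.le), Complex.real_smul]
    push_cast
    field_simp
    ring
  rw [split]
  refine (norm_add_le _ _).trans (add_le_add ?_
    (norm_integral_sub_chord_le hp (fun a b => hd.intervalIntegrable a b) hε hu))
  rw [norm_mul, norm_mul, Complex.norm_real]
  calc ‖u * (u - p) / 2 / p‖ * (‖p * l / (1 - z)‖ * ‖1 - z‖)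
      ≤ p / 8 * (‖p * l / (1 - z)‖ * ‖1 - z‖) := by gcongr
    _ = p * ‖p * l / (1 - z)‖ * (‖1 - z‖ / 8) := by ring

theorem norm_meanDeviation_charPrimitive_le (hW : IsPeriodicWithMean W p l) (hp : 0 < p)
    (hz : ‖z‖ = 1) (hz1 : z ≠ 1) (hM : ∀ c : ℤ, ‖1 - z ^ c‖ ≤ M)
    (hε : ∀ x, ‖meanDeviation W l x‖ ≤ ε) (x : ℝ) :
    ‖meanDeviation (charPrimitive z p W) (p * l / (1 - z)) x‖
      ≤ p * ‖p * l / (1 - z)‖ * (‖1 + z‖ * M / (2 * ‖1 - z‖) + ‖1 - z‖ / 8)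
        + p * ε * (M / ‖1 - z‖ + 1 / 2) := by
  have hM0 : 0 ≤ M := (norm_nonneg _).trans (hM 0)
  have h1 : ‖1 - z‖ ≠ 0 := norm_ne_zero_iff.2 (sub_ne_zero.2 hz1.symm)
  refine (norm_le_of_affine hp hz hz1 (hW.meanDeviation_charPrimitive_add hp hz hz1) hM
    (fun u => hW.norm_meanDeviation_charPrimitive_sub_chord_le hp hz hz1 hε) x).trans ?_
  calc _ ≤ (p * ‖p * l / (1 - z)‖ * (‖1 + z‖ / 2) + p * ε) / ‖1 - z‖ * M
        + (p * ‖p * l / (1 - z)‖ * (‖1 - z‖ / 8) + p * ε / 2) := by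
        gcongr
        exact hW.norm_meanDeviation_charPrimitive_period_le hp hz hz1 hε
    _ = _ := by
        field_simp
        ring

end IsPeriodicWithMean

end charPrimitive

/-! ### Iterated primitives of Walsh functions -/

/-- The iterated primitive of the product of the step characters of the digits at the positions in
an increasing list, where `z a` is the root of unity attached to the position `a`. -/
def walshPrimitive (b : ℕ) (z : ℕ → ℂ) : List ℕ → ℝ → ℂ
  | [] => fun _ => 1
  | a :: L => charPrimitive (z a) ((b : ℝ) ^ a)⁻¹ (walshPrimitive b z L)

/-- The mean value of `walshPrimitive b z L`. -/
def walshMean (b : ℕ) (z : ℕ → ℂ) : List ℕ → ℂ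
  | [] => 1
  | a :: L => (((b : ℝ) ^ a)⁻¹ : ℝ) * walshMean b z L / (1 - z a)

section walshPrimitive

variable {b : ℕ} {z : ℕ → ℂ}

theorem inv_pow_pos (hb : b ≠ 0) (a : ℕ) : 0 < ((b : ℝ) ^ a)⁻¹ := by
  have : (0 : ℝ) < b := by exact_mod_cast Nat.pos_of_ne_zero hb
  positivity

theorem exists_nsmul_inv_pow_eq {a c : ℕ} (hb : b ≠ 0) (hac : a < c) :
    ∃ n : ℕ, n ≠ 0 ∧ n • b • ((b : ℝ) ^ c)⁻¹ = ((b : ℝ) ^ a)⁻¹ := by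
  obtain ⟨n, rfl⟩ := Nat.exists_eq_add_of_lt hac
  have : (b : ℝ) ≠ 0 := by exact_mod_cast hb
  refine ⟨b ^ n, pow_ne_zero n hb, ?_⟩
  rw [nsmul_eq_mul, nsmul_eq_mul]
  push_cast
  field_simp
  ring

theorem isPeriodicWithMean_walshPrimitive {L : List ℕ} (hz : ∀ c ∈ L, IsNontrivialRoot b (z c))
    {a : ℕ} (hL : (a :: L).Pairwise (· < ·)) :
    IsPeriodicWithMean (walshPrimitive b z L) ((b : ℝ) ^ a)⁻¹ (walshMean b z L) := by
  induction L generalizing a with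
  | nil => exact ⟨continuous_const, fun _ => rfl, by simp [walshPrimitive, walshMean]⟩
  | cons c L ih =>
    obtain ⟨hc, hz⟩ := List.forall_mem_cons.1 hz
    obtain ⟨hac, hL⟩ := List.pairwise_cons.1 hL
    obtain ⟨n, -, hn⟩ := exists_nsmul_inv_pow_eq hc.ne_zero (hac c List.mem_cons_self)
    rw [← hn]
    exact ((ih hz hL).charPrimitive (inv_pow_pos hc.ne_zero c) hc).nsmul n

theorem norm_walshMean_cons {a : ℕ} (ha : IsNontrivialRoot b (z a)) (L : List ℕ) :
    ‖walshMean b z (a :: L)‖ = ((b : ℝ) ^ a)⁻¹ * ‖walshMean b z L‖ / ‖1 - z a‖ := by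
  rw [walshMean, norm_div, norm_mul, Complex.norm_real,
    Real.norm_of_nonneg (inv_pow_pos ha.ne_zero a).le]

theorem norm_walshMean_le (hb : 2 ≤ b) {L : List ℕ} (hz : ∀ c ∈ L, IsNontrivialRoot b (z c)) :
    ‖walshMean b z L‖ ≤ ((b : ℝ) ^ L.sum)⁻¹ * (mConst b)⁻¹ ^ L.length := by
  have hm := mConst_pos hb
  induction L with
  | nil => simp [walshMean]
  | cons a L ih =>
    obtain ⟨ha, hz⟩ := List.forall_mem_cons.1 hz
    have hma := ha.mConst_le
    rw [norm_walshMean_cons ha]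
    calc ((b : ℝ) ^ a)⁻¹ * ‖walshMean b z L‖ / ‖1 - z a‖
        ≤ ((b : ℝ) ^ a)⁻¹ * (((b : ℝ) ^ L.sum)⁻¹ * (mConst b)⁻¹ ^ L.length) / mConst b := by
          gcongr
          exact ih hz
      _ = ((b : ℝ) ^ (a :: L).sum)⁻¹ * (mConst b)⁻¹ ^ (a :: L).length := by
          rw [List.sum_cons, List.length_cons, pow_add, mul_inv, pow_succ]
          ring

theorem norm_meanDeviation_walshPrimitive_le (hb : 3 ≤ b) {L : List ℕ}
    (hz : ∀ c ∈ L, IsNontrivialRoot b (z c)) {a : ℕ} (hL : (a :: L).Pairwise (· < ·)) (x : ℝ) :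
    ‖meanDeviation (walshPrimitive b z L) (walshMean b z L) x‖
      ≤ ((b : ℝ) ^ a)⁻¹ * ‖walshMean b z L‖ * deviationConst b := by
  have hB := deviationConst_nonneg hb
  induction L generalizing a x with
  | nil =>
    rw [meanDeviation]
    simp only [walshPrimitive, walshMean, sub_self, intervalIntegral.integral_zero, norm_zero]
    positivity
  | cons c L ih =>
    obtain ⟨hc, hz⟩ := List.forall_mem_cons.1 hz
    obtain ⟨hac, hL⟩ := List.pairwise_cons.1 hL
    obtain ⟨n, hn0, hn⟩ := exists_nsmul_inv_pow_eq hc.ne_zero (hac c List.mem_cons_self)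
    have hp := inv_pow_pos hc.ne_zero c
    have hd : ‖1 - z c‖ ≠ 0 := norm_ne_zero_iff.2 (sub_ne_zero.2 hc.ne_one.symm)
    have hn1 : (1 : ℝ) ≤ n := by exact_mod_cast Nat.one_le_iff_ne_zero.2 hn0
    calc ‖meanDeviation (walshPrimitive b z (c :: L)) (walshMean b z (c :: L)) x‖
        ≤ ((b : ℝ) ^ c)⁻¹ * ‖walshMean b z (c :: L)‖
            * (‖1 + z c‖ * MConst b / (2 * ‖1 - z c‖) + ‖1 - z c‖ / 8)
          + ((b : ℝ) ^ c)⁻¹ * (((b : ℝ) ^ c)⁻¹ * ‖walshMean b z L‖ * deviationConst b)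
            * (MConst b / ‖1 - z c‖ + 1 / 2) :=
          (isPeriodicWithMean_walshPrimitive hz hL).norm_meanDeviation_charPrimitive_le hp
            hc.norm_eq_one hc.ne_one hc.norm_one_sub_zpow_le_MConst (ih hz hL) x
      _ = ((b : ℝ) ^ c)⁻¹ * ‖walshMean b z (c :: L)‖
            * (‖1 + z c‖ * MConst b / (2 * ‖1 - z c‖) + ‖1 - z c‖ / 8
              + deviationConst b * (MConst b + ‖1 - z c‖ / 2)) := by
          rw [norm_walshMean_cons hc]
          field_simp
      _ ≤ ((b : ℝ) ^ c)⁻¹ * ‖walshMean b z (c :: L)‖ * (n * (b * deviationConst b)) := by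
          gcongr
          refine (hc.deviation_le hb).trans (le_mul_of_one_le_left ?_ hn1)
          positivity
      _ = ((b : ℝ) ^ a)⁻¹ * ‖walshMean b z (c :: L)‖ * deviationConst b := by
          rw [← hn, nsmul_eq_mul, nsmul_eq_mul]
          ring

section ComplexOrder

open scoped ComplexOrder

theorem charPrimitive_neg_one_mem_Icc {W : ℝ → ℂ} {p : ℝ} (hp : 0 < p) (hW : Continuous W)
    (hper : Periodic W p) (hW0 : ∀ x, 0 ≤ W x) (x : ℝ) :
    charPrimitive (-1) p W x ∈ Icc 0 (∫ t in 0..p, W t) := by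
  have hF := charPrimitive_add (z := -1) (by simp) hp hW hper
  have nonneg {a c : ℝ} (hac : a ≤ c) : 0 ≤ ∫ t in a..c, W t := by
    rw [intervalIntegral.integral_of_le hac]
    exact integral_nonneg hW0
  have base {u : ℝ} (hu : u ∈ Icc 0 p) :
      charPrimitive (-1) p W u ∈ Icc 0 (∫ t in 0..p, W t) := by
    rw [charPrimitive_of_mem_Icc hu, ← intervalIntegral.integral_add_adjacent_intervals
      (hW.intervalIntegrable 0 u) (hW.intervalIntegrable u p)]
    exact ⟨nonneg hu.1, le_add_of_nonneg_right (nonneg hu.2)⟩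
  obtain ⟨y, hy, hxy⟩ := (periodic_of_affine two_ne_zero neg_one_sq (by norm_num) hF
    ).exists_mem_Ico₀ (nsmul_pos hp two_ne_zero) x
  rw [two_nsmul] at hy
  rw [hxy]
  rcases le_total y p with hyp | hyp
  · exact base ⟨hy.1, hyp⟩
  · have hu := base (u := y - p) ⟨by linarith, by linarith [hy.2]⟩
    rw [← sub_add_cancel y p, hF, charPrimitive_of_mem_Icc (right_mem_Icc.2 hp.le), neg_one_mul,
      ← sub_eq_add_neg]
    exact ⟨sub_nonneg.2 hu.2, sub_le_self _ hu.1⟩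

theorem walshPrimitive_two_nonneg {L : List ℕ} (hz : ∀ c ∈ L, IsNontrivialRoot 2 (z c))
    (hL : L.Pairwise (· < ·)) (x : ℝ) : 0 ≤ walshPrimitive 2 z L x := by
  induction L generalizing x with
  | nil => exact zero_le_one
  | cons a L ih =>
    obtain ⟨ha, hz⟩ := List.forall_mem_cons.1 hz
    have hW := isPeriodicWithMean_walshPrimitive hz hL
    rw [walshPrimitive, ha.eq_neg_one]
    exact (charPrimitive_neg_one_mem_Icc (inv_pow_pos two_ne_zero a) hW.continuous hW.periodic
      (ih hz hL.of_cons) x).1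

theorem norm_walshPrimitive_two_cons_le {a : ℕ} {L : List ℕ}
    (hz : ∀ c ∈ a :: L, IsNontrivialRoot 2 (z c)) (hL : (a :: L).Pairwise (· < ·)) (x : ℝ) :
    ‖walshPrimitive 2 z (a :: L) x‖ ≤ (((2 : ℕ) : ℝ) ^ a)⁻¹ * ‖walshMean 2 z L‖ := by
  obtain ⟨ha, hz⟩ := List.forall_mem_cons.1 hz
  have hp := inv_pow_pos two_ne_zero a
  have hW := isPeriodicWithMean_walshPrimitive hz hL
  have h := charPrimitive_neg_one_mem_Icc hp hW.continuous hW.periodic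
    (walshPrimitive_two_nonneg hz hL.of_cons) x
  rw [walshPrimitive, ha.eq_neg_one]
  refine (CStarAlgebra.norm_le_norm_of_nonneg_of_le h.1 h.2).trans_eq ?_
  rw [hW.integral_eq, norm_mul, Complex.norm_real, Real.norm_of_nonneg hp.le]

end ComplexOrder

theorem norm_walshPrimitive_cons_le_of_three_le (hb : 3 ≤ b) {a : ℕ} {L : List ℕ}
    (hz : ∀ c ∈ a :: L, IsNontrivialRoot b (z c)) (hL : (a :: L).Pairwise (· < ·)) (x : ℝ) :
    ‖walshPrimitive b z (a :: L) x‖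
      ≤ ((b : ℝ) ^ a)⁻¹ * ‖walshMean b z L‖ * (MConst b / mConst b + deviationConst b) := by
  obtain ⟨ha, hz⟩ := List.forall_mem_cons.1 hz
  have hp := inv_pow_pos ha.ne_zero a
  have hm := mConst_pos (show 2 ≤ b by omega)
  have hM := MConst_nonneg b
  have hma := ha.mConst_le
  calc ‖walshPrimitive b z (a :: L) x‖
      ≤ ‖walshMean b z (a :: L)‖ * MConst b
        + ((b : ℝ) ^ a)⁻¹ * ‖walshMean b z L‖ * deviationConst b :=
        (isPeriodicWithMean_walshPrimitive hz hL).norm_charPrimitive_le hp ha.norm_eq_one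
          ha.ne_one ha.norm_one_sub_zpow_le_MConst (norm_meanDeviation_walshPrimitive_le hb hz hL) x
    _ ≤ ((b : ℝ) ^ a)⁻¹ * ‖walshMean b z L‖ / mConst b * MConst b
        + ((b : ℝ) ^ a)⁻¹ * ‖walshMean b z L‖ * deviationConst b := by
        rw [norm_walshMean_cons ha]
        gcongr
    _ = ((b : ℝ) ^ a)⁻¹ * ‖walshMean b z L‖ * (MConst b / mConst b + deviationConst b) := by ring

theorem norm_walshPrimitive_cons_le (hb : 2 ≤ b) {a : ℕ} {L : List ℕ}
    (hz : ∀ c ∈ a :: L, IsNontrivialRoot b (z c)) (hL : (a :: L).Pairwise (· < ·)) (x : ℝ) :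
    ‖walshPrimitive b z (a :: L) x‖
      ≤ ((b : ℝ) ^ a)⁻¹ * ‖walshMean b z L‖ * ((mConst b)⁻¹ * CConst b) := by
  rcases hb.eq_or_lt with rfl | hb3
  · rw [mConst_two, CConst, if_pos rfl, inv_mul_cancel₀ two_ne_zero, mul_one]
    exact norm_walshPrimitive_two_cons_le hz hL x
  · refine (norm_walshPrimitive_cons_le_of_three_le hb3 hz hL x).trans_eq ?_
    have hm := (mConst_pos hb).ne'
    have hbM := (sub_MConst_pos hb3).ne'
    rw [CConst, if_neg (by omega), deviationConst]
    field_simp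

theorem norm_walshPrimitive_le (hb : 2 ≤ b) {L : List ℕ} (hz : ∀ c ∈ L, IsNontrivialRoot b (z c))
    (hL : L.Pairwise (· < ·)) (x : ℝ) :
    ‖walshPrimitive b z L x‖
      ≤ ((b : ℝ) ^ L.sum)⁻¹ * ((mConst b)⁻¹ ^ L.length * CConst b ^ min 1 L.length) := by
  cases L with
  | nil => simp [walshPrimitive]
  | cons a L =>
    have hm := mConst_pos hb
    have hC := CConst_nonneg hb
    calc ‖walshPrimitive b z (a :: L) x‖
        ≤ ((b : ℝ) ^ a)⁻¹ * ‖walshMean b z L‖ * ((mConst b)⁻¹ * CConst b) :=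
          norm_walshPrimitive_cons_le hb hz hL x
      _ ≤ ((b : ℝ) ^ a)⁻¹ * (((b : ℝ) ^ L.sum)⁻¹ * (mConst b)⁻¹ ^ L.length)
          * ((mConst b)⁻¹ * CConst b) := by
          gcongr
          exact norm_walshMean_le hb fun c hc => hz c (List.mem_cons_of_mem a hc)
      _ = _ := by
          rw [List.sum_cons, List.length_cons, min_eq_left (by omega), pow_add, mul_inv,
            pow_succ, pow_one]
          ring

end walshPrimitive

/-! ### Integration by parts against Walsh functions -/

theorem continuous_stepChar_mul {z : ℂ} (hz : ‖z‖ = 1) {p : ℝ} {G : ℝ → ℂ} (hG : Continuous G)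
    (hG0 : ∀ (x : ℝ) (n : ℤ), x / p = n → G x = 0) :
    Continuous fun x => stepChar z p x * G x := by
  refine continuous_iff_continuousAt.2 fun x => ?_
  by_cases hx : ∃ n : ℤ, x / p = n
  · obtain ⟨n, hn⟩ := hx
    have hlim : Tendsto G (𝓝 x) (𝓝 0) := hG0 x n hn ▸ hG.tendsto x
    rw [ContinuousAt, hG0 x n hn, mul_zero]
    refine squeeze_zero_norm (fun y => ?_) (tendsto_zero_iff_norm_tendsto_zero.1 hlim)
    rw [norm_mul, norm_stepChar hz, one_mul]
  · have hstep : ContinuousAt (stepChar z p) x :=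
      continuousAt_const.congr_of_eventuallyEq (stepChar_eventuallyEq_nhds z (not_exists.1 hx))
    exact hstep.mul hG.continuousAt

/-- The product of the step characters of the digits at the positions in a list, where `z a` is the
root of unity attached to the position `a`. -/
def charProd (b : ℕ) (z : ℕ → ℂ) (L : List ℕ) (x : ℝ) : ℂ :=
  (L.map fun a => stepChar (z a) ((b : ℝ) ^ a)⁻¹ x).prod

section charProd

variable {b : ℕ} {z : ℕ → ℂ}

theorem charProd_nil (x : ℝ) : charProd b z [] x = 1 := rfl

theorem charProd_cons (a : ℕ) (L : List ℕ) (x : ℝ) :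
    charProd b z (a :: L) x = stepChar (z a) ((b : ℝ) ^ a)⁻¹ x * charProd b z L x := by
  simp [charProd]

theorem charProd_concat (L : List ℕ) (a : ℕ) (x : ℝ) :
    charProd b z (L ++ [a]) x = charProd b z L x * stepChar (z a) ((b : ℝ) ^ a)⁻¹ x := by
  simp [charProd]

theorem measurable_charProd (b : ℕ) (z : ℕ → ℂ) (L : List ℕ) : Measurable (charProd b z L) := by
  induction L with
  | nil => exact measurable_const
  | cons a L ih => exact (funext (charProd_cons a L)) ▸ (measurable_stepChar _ _).mul ih

theorem norm_charProd {L : List ℕ} (hz : ∀ a ∈ L, ‖z a‖ = 1) (x : ℝ) :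
    ‖charProd b z L x‖ = 1 := by
  induction L with
  | nil => exact norm_one
  | cons a L ih =>
    obtain ⟨ha, hz⟩ := List.forall_mem_cons.1 hz
    rw [charProd_cons, norm_mul, norm_stepChar ha, ih hz, one_mul]

theorem intervalIntegrable_charProd_mul {L : List ℕ} (hz : ∀ a ∈ L, ‖z a‖ = 1) {W : ℝ → ℂ}
    (hW : Continuous W) (x y : ℝ) :
    IntervalIntegrable (fun t => charProd b z L t * W t) volume x y := by
  rw [intervalIntegrable_iff]
  exact (hW.intervalIntegrable x y).def'.bdd_mul (c := 1)
    (measurable_charProd b z L).aestronglyMeasurable (.of_forall fun t => (norm_charProd hz t).le)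

theorem charProd_eventuallyEq_nhdsGE (hb : b ≠ 0) (L : List ℕ) (x : ℝ) :
    ∀ᶠ y in 𝓝[≥] x, charProd b z L y = charProd b z L x := by
  induction L with
  | nil => exact .of_forall fun _ => rfl
  | cons a L ih =>
    filter_upwards [ih, stepChar_eventuallyEq_nhdsGE (z a) (inv_pow_pos hb a) x] with y hL ha
    rw [charProd_cons, charProd_cons, hL, ha]

theorem walshPrimitive_cons_eq_zero {a c : ℕ} {L : List ℕ}
    (hz : ∀ d ∈ a :: L, IsNontrivialRoot b (z d)) (hL : (a :: L).Pairwise (· < ·)) (hca : c < a)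
    {x : ℝ} {n : ℤ} (hx : x / ((b : ℝ) ^ c)⁻¹ = n) : walshPrimitive b z (a :: L) x = 0 := by
  have hb := (hz a List.mem_cons_self).ne_zero
  have hcL : (c :: a :: L).Pairwise (· < ·) :=
    List.pairwise_cons_cons_iff_of_trans.2 ⟨hca, hL⟩
  rw [(div_eq_iff (inv_pow_pos hb c).ne').1 hx,
    (isPeriodicWithMean_walshPrimitive hz hcL).periodic.int_mul_eq]
  exact charPrimitive_zero

theorem continuous_charProd_mul_walshPrimitive {a : ℕ} {L₁ L₂ : List ℕ}
    (hz₁ : ∀ c ∈ L₁, ‖z c‖ = 1) (hz₂ : ∀ c ∈ a :: L₂, IsNontrivialRoot b (z c))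
    (hlt : ∀ c ∈ L₁, c < a) (hL₂ : (a :: L₂).Pairwise (· < ·)) :
    Continuous fun x => charProd b z L₁ x * walshPrimitive b z (a :: L₂) x := by
  induction L₁ with
  | nil =>
    obtain ⟨ha, hz⟩ := List.forall_mem_cons.1 hz₂
    simp only [charProd_nil, one_mul]
    exact continuous_charPrimitive ha.norm_eq_one _
      (isPeriodicWithMean_walshPrimitive hz hL₂).continuous
  | cons c L₁ ih =>
    obtain ⟨hc, hz₁⟩ := List.forall_mem_cons.1 hz₁
    obtain ⟨hca, hlt⟩ := List.forall_mem_cons.1 hlt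
    simp only [charProd_cons, mul_assoc]
    refine continuous_stepChar_mul hc (ih hz₁ hlt) fun x n hx => ?_
    rw [walshPrimitive_cons_eq_zero hz₂ hL₂ hca hx, mul_zero]

theorem hasDerivWithinAt_charProd_mul_walshPrimitive {a : ℕ} (ha : IsNontrivialRoot b (z a))
    (L₁ : List ℕ) {L₂ : List ℕ} (hW : Continuous (walshPrimitive b z L₂)) (x : ℝ) :
    HasDerivWithinAt (fun y => charProd b z L₁ y * walshPrimitive b z (a :: L₂) y)
      (charProd b z (L₁ ++ [a]) x * walshPrimitive b z L₂ x) (Ioi x) x := by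
  have hprim := hasDerivWithinAt_charPrimitive ha.norm_eq_one (inv_pow_pos ha.ne_zero a) hW x
  rw [charProd_concat, mul_assoc]
  refine (hprim.const_mul (charProd b z L₁ x)).congr_of_eventuallyEq ?_ rfl
  filter_upwards [nhdsWithin_mono x Ioi_subset_Ici_self
    (charProd_eventuallyEq_nhdsGE (z := z) ha.ne_zero L₁ x)] with y hy
  rw [hy, walshPrimitive]

theorem integral_mul_charProd_concat {g : ℝ → ℂ} (hg : ContDiffOn ℝ 1 g (Icc 0 1))
    {a : ℕ} (ha : 0 < a) {L₁ L₂ : List ℕ} (hz : ∀ c ∈ L₁ ++ a :: L₂, IsNontrivialRoot b (z c))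
    (hL : (L₁ ++ a :: L₂).Pairwise (· < ·)) :
    ∫ x in 0..1, g x * (charProd b z (L₁ ++ [a]) x * walshPrimitive b z L₂ x)
      = -∫ x in 0..1, derivWithin g (Icc 0 1) x *
        (charProd b z L₁ x * walshPrimitive b z (a :: L₂) x) := by
  obtain ⟨hz₁, hz₂⟩ := List.forall_mem_append.1 hz
  obtain ⟨hza, hz₂'⟩ := List.forall_mem_cons.1 hz₂
  obtain ⟨-, hL₂, hlt⟩ := List.pairwise_append.1 hL
  have hlt_a : ∀ c ∈ L₁, c < a := fun c hc => hlt c hc a List.mem_cons_self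
  have hnorm₁ : ∀ c ∈ L₁, ‖z c‖ = 1 := fun c hc => (hz₁ c hc).norm_eq_one
  have hW := (isPeriodicWithMean_walshPrimitive hz₂' hL₂).continuous
  have hnorm : ∀ c ∈ L₁ ++ [a], ‖z c‖ = 1 :=
    List.forall_mem_append.2 ⟨hnorm₁, by simpa using hza.norm_eq_one⟩
  have hu' : IntervalIntegrable (derivWithin g (Icc 0 1)) volume 0 1 :=
    (hg.continuousOn_derivWithin (uniqueDiffOn_Icc zero_lt_one)
      le_rfl).intervalIntegrable_of_Icc zero_le_one
  have hu : ∀ x ∈ Ioo (0 : ℝ) 1, HasDerivWithinAt g (derivWithin g (Icc 0 1) x) (Ioi x) x :=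
    fun x hx => (((hg.differentiableOn one_ne_zero x ⟨hx.1.le, hx.2.le⟩).hasDerivWithinAt
      ).hasDerivAt (Icc_mem_nhds hx.1 hx.2)).hasDerivWithinAt
  have hv₀ : walshPrimitive b z (a :: L₂) 0 = 0 :=
    walshPrimitive_cons_eq_zero hz₂ hL₂ ha (n := 0) (by simp)
  have hv₁ : walshPrimitive b z (a :: L₂) 1 = 0 :=
    walshPrimitive_cons_eq_zero hz₂ hL₂ ha (n := 1) (by simp)
  rw [intervalIntegral.integral_mul_deriv_eq_deriv_mul_of_hasDeriv_right
    (uIcc_of_le (zero_le_one' ℝ) ▸ hg.continuousOn)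
    (continuous_charProd_mul_walshPrimitive hnorm₁ hz₂ hlt_a hL₂).continuousOn
    (by simpa only [min_eq_left zero_le_one, max_eq_right zero_le_one] using hu)
    (fun x _ => hasDerivWithinAt_charProd_mul_walshPrimitive hza L₁ hW x) hu'
    (intervalIntegrable_charProd_mul hnorm hW 0 1), hv₀, hv₁]
  ring

theorem integral_mul_charProd_mul_walshPrimitive {g : ℝ → ℂ} {L₁ L₂ : List ℕ}
    (hg : ContDiffOn ℝ L₁.length g (Icc 0 1)) (hpos : ∀ a ∈ L₁, 0 < a)
    (hz : ∀ c ∈ L₁ ++ L₂, IsNontrivialRoot b (z c)) (hL : (L₁ ++ L₂).Pairwise (· < ·)) :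
    ∫ x in 0..1, g x * (charProd b z L₁ x * walshPrimitive b z L₂ x)
      = (-1) ^ L₁.length * ∫ x in 0..1, iteratedDerivWithin L₁.length g (Icc 0 1) x *
        walshPrimitive b z (L₁ ++ L₂) x := by
  induction L₁ using List.reverseRecOn generalizing L₂ g with
  | nil => simp [charProd_nil]
  | append_singleton L a ih =>
    obtain ⟨hposL, hpos_a⟩ := List.forall_mem_append.1 hpos
    rw [List.length_append, List.length_singleton] at hg ⊢
    rw [List.append_assoc, List.singleton_append] at hz hL ⊢
    rw [integral_mul_charProd_concat (hg.of_le (by norm_cast; omega)) (hpos_a a (by simp)) hz hL,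
      ih (hg.derivWithin (uniqueDiffOn_Icc zero_lt_one) (by norm_cast)) hposL hz hL,
      iteratedDerivWithin_succ', pow_succ]
    ring

end charProd

/-! ### Mixed derivatives and integrals over the unit cube -/

section unitCube

variable {s : ℕ}

theorem measurableSet_unitCube (s : ℕ) : MeasurableSet (unitCube s) :=
  MeasurableSet.univ_pi fun _ => measurableSet_Ico

theorem unitCube_subset_Icc (s : ℕ) : unitCube s ⊆ Icc 0 1 := fun _ hx =>
  ⟨fun j => (hx j (mem_univ j)).1, fun j => (hx j (mem_univ j)).2.le⟩

theorem integrableOn_unitCube {g : (Fin s → ℝ) → ℂ} (hg : ContinuousOn g (Icc 0 1)) :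
    IntegrableOn g (unitCube s) :=
  (hg.integrableOn_compact isCompact_Icc).mono_set (unitCube_subset_Icc s)

theorem insertNth_mem_unitCube (j : Fin (s + 1)) {t : ℝ} {y : Fin s → ℝ} :
    j.insertNth (α := fun _ => ℝ) t y ∈ unitCube (s + 1) ↔ t ∈ Ico 0 1 ∧ y ∈ unitCube s := by
  simp only [unitCube, mem_univ_pi, j.forall_iff_succAbove, Fin.insertNth_apply_same,
    Fin.insertNth_apply_succAbove]

theorem integral_unitCube_insertNth (j : Fin (s + 1)) {F : (Fin (s + 1) → ℝ) → ℂ}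
    (hF : IntegrableOn F (unitCube (s + 1))) :
    ∫ x in unitCube (s + 1), F x
      = ∫ y in unitCube s, ∫ t in 0..1, F (j.insertNth (α := fun _ => ℝ) t y) := by
  have hv := (volume_preserving_piFinSuccAbove (fun _ : Fin (s + 1) => ℝ) j).symm
  have he := (MeasurableEquiv.piFinSuccAbove (fun _ : Fin (s + 1) => ℝ) j).symm.measurableEmbedding
  have hpre : (MeasurableEquiv.piFinSuccAbove (fun _ : Fin (s + 1) => ℝ) j).symm ⁻¹'
      unitCube (s + 1) = Ico (0 : ℝ) 1 ×ˢ unitCube s :=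
    Set.ext fun _ => insertNth_mem_unitCube j
  have hF' := (hv.restrict_preimage_emb he (unitCube (s + 1))).integrable_comp_emb he |>.2 hF
  rw [← hv.setIntegral_preimage_emb he]
  rw [hpre, Measure.volume_eq_prod, ← Measure.prod_restrict] at hF' ⊢
  refine (integral_prod_symm _ hF').trans (integral_congr_ae (.of_forall fun y => ?_))
  beta_reduce
  rw [intervalIntegral.integral_of_le zero_le_one, ← integral_Ico_eq_integral_Ioc]
  rfl

theorem integral_unitCube_congr_line (j : Fin s) {F G : (Fin s → ℝ) → ℂ}
    (hF : IntegrableOn F (unitCube s)) (hG : IntegrableOn G (unitCube s))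
    (h : ∀ x ∈ unitCube s,
      ∫ t in 0..1, F (update x j t) = ∫ t in 0..1, G (update x j t)) :
    ∫ x in unitCube s, F x = ∫ x in unitCube s, G x := by
  cases s with
  | zero => exact j.elim0
  | succ s =>
    rw [integral_unitCube_insertNth j hF, integral_unitCube_insertNth j hG]
    refine setIntegral_congr_fun (measurableSet_unitCube s) fun y hy => ?_
    have hx := (insertNth_mem_unitCube j).2 ⟨left_mem_Ico.2 zero_lt_one, hy⟩
    simpa only [Fin.update_insertNth] using h _ hx

theorem update_mem_Icc (j : Fin s) {x : Fin s → ℝ} (hx : x ∈ Icc (0 : Fin s → ℝ) 1)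
    {t : ℝ} (ht : t ∈ Icc (0 : ℝ) 1) : update x j t ∈ Icc (0 : Fin s → ℝ) 1 :=
  ⟨le_update_iff.2 ⟨ht.1, fun i _ => hx.1 i⟩, update_le_iff.2 ⟨ht.2, fun i _ => hx.2 i⟩⟩

theorem uniqueDiffOn_Icc_zero_one (s : ℕ) : UniqueDiffOn ℝ (Icc (0 : Fin s → ℝ) 1) := by
  rw [← pi_univ_Icc]
  exact UniqueDiffOn.univ_pi fun _ => uniqueDiffOn_Icc zero_lt_one

theorem contDiffOn_comp_update {m : WithTop ℕ∞} (j : Fin s) {g : (Fin s → ℝ) → ℂ}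
    (hg : ContDiffOn ℝ m g (Icc 0 1)) {x : Fin s → ℝ} (hx : x ∈ Icc (0 : Fin s → ℝ) 1) :
    ContDiffOn ℝ m (fun t => g (update x j t)) (Icc 0 1) :=
  hg.comp (contDiff_update m x j).contDiffOn fun _ ht => update_mem_Icc j hx ht

theorem contDiffOn_partialDeriv {m : WithTop ℕ∞} (j : Fin s) {g : (Fin s → ℝ) → ℂ}
    (hg : ContDiffOn ℝ (m + 1) g (Icc 0 1)) : ContDiffOn ℝ m (partialDeriv j g) (Icc 0 1) := by
  have hfderiv :
      ContDiffOn ℝ m (fun x => fderivWithin ℝ g (Icc 0 1) x (Pi.single j 1)) (Icc 0 1) :=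
    (hg.fderivWithin (uniqueDiffOn_Icc_zero_one s) le_rfl).clm_apply contDiffOn_const
  refine hfderiv.congr fun x hx => ?_
  have hd : HasFDerivWithinAt g (fderivWithin ℝ g (Icc 0 1) x) (Icc 0 1) x :=
    (hg.differentiableOn (by simp) x hx).hasFDerivWithinAt
  exact (hd.comp_hasDerivWithinAt_of_eq (x j) (hasDerivAt_update x j (x j)).hasDerivWithinAt
    (fun t ht => update_mem_Icc j hx ht) (update_eq_self j x).symm).derivWithin
    (uniqueDiffOn_Icc zero_lt_one _ ⟨hx.1 j, hx.2 j⟩)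

theorem contDiffOn_iterate_partialDeriv {m : ℕ} (j : Fin s) (n : ℕ) {g : (Fin s → ℝ) → ℂ}
    (hg : ContDiffOn ℝ (m + n : ℕ) g (Icc 0 1)) :
    ContDiffOn ℝ m ((partialDeriv j)^[n] g) (Icc 0 1) := by
  induction n generalizing g with
  | zero => exact hg
  | succ n ih => exact ih (contDiffOn_partialDeriv j (by exact_mod_cast hg))

theorem iterate_partialDeriv_update (j : Fin s) (n : ℕ) (g : (Fin s → ℝ) → ℂ)
    (x : Fin s → ℝ) (t : ℝ) :
    (partialDeriv j)^[n] g (update x j t)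
      = iteratedDerivWithin n (fun t => g (update x j t)) (Icc 0 1) t := by
  induction n generalizing t with
  | zero => rfl
  | succ n ih =>
    rw [iterate_succ_apply', iteratedDerivWithin_succ, partialDeriv, update_self]
    simp_rw [update_idem, ih]

/-- The mixed derivative `(∂/∂x_j)^{n_j}` over the coordinates `j` in a list. -/
def listDeriv (n : Fin s → ℕ) (l : List (Fin s)) (f : (Fin s → ℝ) → ℂ) : (Fin s → ℝ) → ℂ :=
  l.foldr (fun j g => (partialDeriv j)^[n j] g) f

theorem contDiffOn_listDeriv {m : ℕ} {n : Fin s → ℕ} (l : List (Fin s)) {f : (Fin s → ℝ) → ℂ}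
    (hf : ContDiffOn ℝ (m + (l.map n).sum : ℕ) f (Icc 0 1)) :
    ContDiffOn ℝ m (listDeriv n l f) (Icc 0 1) := by
  induction l generalizing m with
  | nil => exact hf
  | cons j l ih =>
    rw [List.map_cons, List.sum_cons, ← add_assoc] at hf
    exact contDiffOn_iterate_partialDeriv j (n j) (ih hf)

theorem contDiffOn_mixedDeriv {m : ℕ} {n : Fin s → ℕ} {f : (Fin s → ℝ) → ℂ}
    (hf : ContDiffOn ℝ (m + ∑ j, n j : ℕ) f (Icc 0 1)) :
    ContDiffOn ℝ m (mixedDeriv n f) (Icc 0 1) :=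
  contDiffOn_listDeriv (List.finRange s) (Fin.sum_univ_def n ▸ hf)

/-- `θ` is measurable and bounded. -/
structure IsBoundedMeasurable (θ : ℝ → ℂ) : Prop where
  measurable : Measurable θ
  exists_norm_le : ∃ B, ∀ t, ‖θ t‖ ≤ B

theorem integrableOn_mul_prod {g : (Fin s → ℝ) → ℂ} (hg : ContinuousOn g (Icc 0 1))
    {θ : Fin s → ℝ → ℂ} (hθ : ∀ j, IsBoundedMeasurable (θ j)) :
    IntegrableOn (fun x => g x * ∏ j, θ j (x j)) (unitCube s) := by
  choose B hB using fun j => (hθ j).exists_norm_le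
  have hmeas : Measurable fun x : Fin s → ℝ => ∏ j, θ j (x j) :=
    Finset.measurable_prod _ fun j _ => (hθ j).measurable.comp (measurable_pi_apply j)
  refine (integrableOn_unitCube hg).mul_bdd (c := ∏ j, B j) hmeas.aestronglyMeasurable
    (.of_forall fun x => ?_)
  rw [norm_prod]
  exact Finset.prod_le_prod (fun _ _ => norm_nonneg _) fun j _ => hB j _

theorem prod_apply_update (θ : Fin s → ℝ → ℂ) (j : Fin s) (x : Fin s → ℝ) (t : ℝ) :
    ∏ i, θ i (update x j t i) = θ j t * ∏ i ∈ Finset.univ.erase j, θ i (x i) := by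
  rw [← Finset.mul_prod_erase _ _ (Finset.mem_univ j), update_self]
  congr 1
  exact Finset.prod_congr rfl fun i hi => by rw [update_of_ne (Finset.ne_of_mem_erase hi)]

theorem integral_mul_prod_eq_update {n : ℕ} {g : (Fin s → ℝ) → ℂ}
    (hg : ContDiffOn ℝ n g (Icc 0 1)) {θ : Fin s → ℝ → ℂ}
    (hθ : ∀ j, IsBoundedMeasurable (θ j)) (j : Fin s) {φ : ℝ → ℂ} (hφ : IsBoundedMeasurable φ)
    (hparts : ∀ u : ℝ → ℂ, ContDiffOn ℝ n u (Icc 0 1) →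
      ∫ t in 0..1, u t * θ j t = ∫ t in 0..1, iteratedDerivWithin n u (Icc 0 1) t * φ t) :
    ∫ x in unitCube s, g x * ∏ i, θ i (x i)
      = ∫ x in unitCube s, (partialDeriv j)^[n] g x * ∏ i, update θ j φ i (x i) := by
  have hderiv : ContDiffOn ℝ (0 : ℕ) ((partialDeriv j)^[n] g) (Icc 0 1) :=
    contDiffOn_iterate_partialDeriv j n (by rwa [zero_add])
  have hθ' : ∀ i, IsBoundedMeasurable (update θ j φ i) :=
    (forall_update_iff θ _).2 ⟨hφ, fun i _ => hθ i⟩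
  refine integral_unitCube_congr_line j (integrableOn_mul_prod hg.continuousOn hθ)
    (integrableOn_mul_prod hderiv.continuousOn hθ') fun x hx => ?_
  have hrest : ∏ i ∈ Finset.univ.erase j, update θ j φ i (x i)
      = ∏ i ∈ Finset.univ.erase j, θ i (x i) :=
    Finset.prod_congr rfl fun i hi => by rw [update_of_ne (Finset.ne_of_mem_erase hi)]
  simp_rw [prod_apply_update, hrest, update_self, ← mul_assoc, iterate_partialDeriv_update]
  rw [intervalIntegral.integral_mul_const, intervalIntegral.integral_mul_const,
    hparts _ (contDiffOn_comp_update j hg (unitCube_subset_Icc s hx))]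

theorem integral_mul_prod_eq_listDeriv {n : Fin s → ℕ} {ψ φ : Fin s → ℝ → ℂ}
    (hψ : ∀ j, IsBoundedMeasurable (ψ j)) (hφ : ∀ j, IsBoundedMeasurable (φ j))
    (hparts : ∀ j, ∀ u : ℝ → ℂ, ContDiffOn ℝ (n j) u (Icc 0 1) →
      ∫ t in 0..1, u t * ψ j t = ∫ t in 0..1, iteratedDerivWithin (n j) u (Icc 0 1) t * φ j t)
    {l : List (Fin s)} (hl : l.Nodup) {f : (Fin s → ℝ) → ℂ}
    (hf : ContDiffOn ℝ (l.map n).sum f (Icc 0 1)) :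
    ∫ x in unitCube s, f x * ∏ j, ψ j (x j)
      = ∫ x in unitCube s, listDeriv n l f x * ∏ j, (if j ∈ l then φ j else ψ j) (x j) := by
  induction l with
  | nil => simp [listDeriv]
  | cons j l ih =>
    obtain ⟨hj, hl⟩ := List.nodup_cons.1 hl
    rw [List.map_cons, List.sum_cons] at hf
    have hbdd (i : Fin s) : IsBoundedMeasurable (if i ∈ l then φ i else ψ i) := by
      split_ifs
      exacts [hφ i, hψ i]
    have hupdate : update (fun i => if i ∈ l then φ i else ψ i) j (φ j)
        = fun i => if i ∈ j :: l then φ i else ψ i := by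
      ext i : 1
      rcases eq_or_ne i j with rfl | hij <;> simp [*]
    rw [ih hl (hf.of_le (by norm_cast; omega)),
      integral_mul_prod_eq_update (contDiffOn_listDeriv l hf) hbdd j (hφ j)
        (by simpa only [if_neg hj] using hparts j), hupdate]
    rfl

theorem integral_mul_prod_eq_mixedDeriv {n : Fin s → ℕ} {ψ φ : Fin s → ℝ → ℂ}
    (hψ : ∀ j, IsBoundedMeasurable (ψ j)) (hφ : ∀ j, IsBoundedMeasurable (φ j))
    (hparts : ∀ j, ∀ u : ℝ → ℂ, ContDiffOn ℝ (n j) u (Icc 0 1) →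
      ∫ t in 0..1, u t * ψ j t = ∫ t in 0..1, iteratedDerivWithin (n j) u (Icc 0 1) t * φ j t)
    {f : (Fin s → ℝ) → ℂ} (hf : ContDiffOn ℝ (∑ j, n j : ℕ) f (Icc 0 1)) :
    ∫ x in unitCube s, f x * ∏ j, ψ j (x j)
      = ∫ x in unitCube s, mixedDeriv n f x * ∏ j, φ j (x j) := by
  rw [integral_mul_prod_eq_listDeriv hψ hφ hparts (List.nodup_finRange s)
    (Fin.sum_univ_def n ▸ hf)]
  simp only [List.mem_finRange, if_true]
  rfl

end unitCube

/-! ### Walsh coefficients -/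

theorem natDigit_lt {b : ℕ} (hb : 2 ≤ b) (k i : ℕ) : natDigit b k i < b := by
  rw [natDigit, Nat.getD_digits _ _ hb]
  exact Nat.mod_lt _ (by omega)

theorem pos_of_mem_positions {b k a : ℕ} (ha : a ∈ positions b k) : 0 < a := by
  obtain ⟨i, -, rfl⟩ := Finset.mem_image.1 ha
  exact i.succ_pos

theorem natDigit_ne_zero_of_mem_positions {b k a : ℕ} (ha : a ∈ positions b k) :
    natDigit b k (a - 1) ≠ 0 := by
  obtain ⟨i, hi, rfl⟩ := Finset.mem_image.1 ha
  exact (Finset.mem_filter.1 hi).2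

theorem pairwise_sort_positions (b k : ℕ) : (positions b k).sort.Pairwise (· < ·) :=
  (Finset.sortedLT_sort _).pairwise

theorem length_sort_positions (b k : ℕ) : (positions b k).sort.length = hammingWeight b k :=
  Finset.length_sort _

theorem sum_sort_positions (b k : ℕ) : (positions b k).sort.sum = mu b k := by
  rw [← Multiset.sum_coe, Finset.sort_eq]
  exact congrArg Multiset.sum (Multiset.map_id' _).symm

/-- The root of unity `ω̄ ^ κ` attached to the digit `κ` of `k` at position `a`. -/
def digitRoot (b k a : ℕ) : ℂ := starRingEnd ℂ (omega b) ^ natDigit b k (a - 1)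

theorem isNontrivialRoot_digitRoot {b : ℕ} (hb : 2 ≤ b) {k a : ℕ}
    (ha : a ∈ (positions b k).sort) : IsNontrivialRoot b (digitRoot b k a) := by
  have hb0 : b ≠ 0 := by omega
  have hroot := isPrimitiveRoot_conj_omega hb0
  refine ⟨hb0, ?_, hroot.pow_ne_one_of_pos_of_lt
    (natDigit_ne_zero_of_mem_positions ((Finset.mem_sort _).1 ha)) (natDigit_lt hb _ _)⟩
  rw [digitRoot, ← pow_mul, mul_comm, pow_mul, hroot.pow_eq_one, one_pow]

theorem stepChar_eq_pow_digit {b : ℕ} [NeZero b] {z : ℂ} (hz : z ^ b = 1) {a : ℕ} (ha : 0 < a)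
    {x : ℝ} (hx : 0 ≤ x) :
    stepChar z ((b : ℝ) ^ a)⁻¹ x = z ^ (Real.digits x b (a - 1) : ℕ) := by
  have hxa : 0 ≤ x * (b : ℝ) ^ a := by positivity
  rw [stepChar, div_inv_eq_mul, ← Int.natCast_floor_eq_floor hxa, zpow_natCast, Real.digits,
    Fin.val_ofNat, Nat.sub_add_cancel ha, ← pow_eq_pow_mod _ hz]

/-- The complex conjugate of `wal b k` on `[0, ∞)`, as a product of step characters. -/
def walshChar (b k : ℕ) : ℝ → ℂ := charProd b (digitRoot b k) (positions b k).sort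

/-- The kernel against which the derivative of order `hammingWeight b k` of a function is to be
integrated in order to obtain its `k`-th Walsh coefficient. -/
def walshKernel (b k : ℕ) (x : ℝ) : ℂ :=
  (-1) ^ hammingWeight b k * walshPrimitive b (digitRoot b k) (positions b k).sort x

/-- The bound `b^{-μ(k)} m_b^{-v(k)} C_b^{min(1, v(k))}` for `walshKernel b k`. -/
def kernelBound (b k : ℕ) : ℝ :=
  ((b : ℝ) ^ mu b k)⁻¹ *
    ((mConst b)⁻¹ ^ hammingWeight b k * CConst b ^ min 1 (hammingWeight b k))

section walshKernel

variable {b : ℕ}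

theorem conj_wal [NeZero b] (hb : 2 ≤ b) (k : ℕ) {x : ℝ} (hx : 0 ≤ x) :
    starRingEnd ℂ (wal b k x) = walshChar b k x := by
  have hprod : walshChar b k x
      = ∏ a ∈ positions b k, stepChar (digitRoot b k a) ((b : ℝ) ^ a)⁻¹ x := by
    rw [walshChar, charProd, ← Multiset.prod_coe, ← Multiset.map_coe, Finset.sort_eq]
    rfl
  rw [hprod, wal, map_pow, ← Finset.prod_pow_eq_pow_sum]
  refine Finset.prod_congr rfl fun a ha => ?_
  have hroot := isNontrivialRoot_digitRoot hb ((Finset.mem_sort _).2 ha)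
  rw [stepChar_eq_pow_digit hroot.pow_eq_one (pos_of_mem_positions ha) hx, digitRoot, pow_mul]

theorem isBoundedMeasurable_walshChar (hb : 2 ≤ b) (k : ℕ) :
    IsBoundedMeasurable (walshChar b k) :=
  ⟨measurable_charProd _ _ _, 1, fun x => (norm_charProd
    (fun _ ha => (isNontrivialRoot_digitRoot hb ha).norm_eq_one) x).le⟩

theorem norm_walshKernel_le (hb : 2 ≤ b) (k : ℕ) (x : ℝ) :
    ‖walshKernel b k x‖ ≤ kernelBound b k := by
  have h := norm_walshPrimitive_le hb (fun _ => isNontrivialRoot_digitRoot hb)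
    (pairwise_sort_positions b k) x
  rw [sum_sort_positions, length_sort_positions] at h
  rwa [walshKernel, norm_mul, norm_pow, norm_neg, norm_one, one_pow, one_mul]

theorem isBoundedMeasurable_walshKernel (hb : 2 ≤ b) (k : ℕ) :
    IsBoundedMeasurable (walshKernel b k) := by
  have hpos : (0 :: (positions b k).sort).Pairwise (· < ·) := List.pairwise_cons.2
    ⟨fun _ ha => pos_of_mem_positions ((Finset.mem_sort _).1 ha), pairwise_sort_positions b k⟩
  have hcont := (isPeriodicWithMean_walshPrimitive
    (fun _ => isNontrivialRoot_digitRoot hb) hpos).continuous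
  exact ⟨hcont.measurable.const_mul _, kernelBound b k, norm_walshKernel_le hb k⟩

theorem integral_mul_walshChar (hb : 2 ≤ b) (k : ℕ) {g : ℝ → ℂ}
    (hg : ContDiffOn ℝ (hammingWeight b k) g (Icc 0 1)) :
    ∫ t in 0..1, g t * walshChar b k t
      = ∫ t in 0..1, iteratedDerivWithin (hammingWeight b k) g (Icc 0 1) t *
        walshKernel b k t := by
  have hparts := integral_mul_charProd_mul_walshPrimitive (z := digitRoot b k)
    (L₁ := (positions b k).sort) (L₂ := []) ((length_sort_positions b k).symm ▸ hg)
    (fun a ha => pos_of_mem_positions ((Finset.mem_sort _).1 ha))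
    (by simpa only [List.append_nil] using fun _ => isNontrivialRoot_digitRoot hb)
    (by simpa only [List.append_nil] using pairwise_sort_positions b k)
  simp only [List.append_nil, length_sort_positions, walshPrimitive, mul_one] at hparts
  simp only [walshChar, walshKernel, hparts, mul_left_comm _ ((-1 : ℂ) ^ _),
    intervalIntegral.integral_const_mul]

end walshKernel

theorem walshCoeff_eq_integral_mixedDeriv {b : ℕ} [NeZero b] (hb : 2 ≤ b) {s : ℕ}
    {f : (Fin s → ℝ) → ℂ} (k : Fin s → ℕ)
    (hf : ContDiffOn ℝ (∑ j, hammingWeight b (k j) : ℕ) f (Icc 0 1)) :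
    walshCoeff b f k = ∫ x in unitCube s,
      mixedDeriv (fun j => hammingWeight b (k j)) f x * ∏ j, walshKernel b (k j) (x j) := by
  have hchar : walshCoeff b f k = ∫ x in unitCube s, f x * ∏ j, walshChar b (k j) (x j) := by
    refine setIntegral_congr_fun (measurableSet_unitCube s) fun x hx => ?_
    rw [walVec, map_prod]
    congr 1
    exact Finset.prod_congr rfl fun j _ => conj_wal hb (k j) (hx j (mem_univ j)).1
  rw [hchar]
  exact integral_mul_prod_eq_mixedDeriv (fun j => isBoundedMeasurable_walshChar hb (k j))
    (fun j => isBoundedMeasurable_walshKernel hb (k j))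
    (fun j _ hu => integral_mul_walshChar hb (k j) hu) hf

theorem norm_integral_mul_le {α : Type*} [MeasurableSpace α] {μ : Measure α} {g χ : α → ℂ}
    (hg : Integrable g μ) {B : ℝ} (hB : ∀ x, ‖χ x‖ ≤ B) :
    ‖∫ x, g x * χ x ∂μ‖ ≤ (eLpNorm g 1 μ).toReal * B := by
  calc ‖∫ x, g x * χ x ∂μ‖
      ≤ ∫ x, ‖g x‖ * B ∂μ := by
        refine norm_integral_le_of_norm_le (hg.norm.mul_const B) (.of_forall fun x => ?_)
        rw [norm_mul]
        gcongr
        exact hB x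
    _ = (eLpNorm g 1 μ).toReal * B := by
        rw [integral_mul_const, eLpNorm_one_eq_lintegral_enorm,
          integral_norm_eq_lintegral_enorm hg.aestronglyMeasurable]

theorem norm_walshCoeff_le {b : ℕ} [NeZero b] (hb : 2 ≤ b) {s : ℕ} {f : (Fin s → ℝ) → ℂ}
    (k : Fin s → ℕ) (hf : ContDiffOn ℝ (∑ j, hammingWeight b (k j) : ℕ) f (Icc 0 1)) :
    ‖walshCoeff b f k‖
      ≤ (L1norm (mixedDeriv (fun j => hammingWeight b (k j)) f)).toReal *
        ∏ j, kernelBound b (k j) := by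
  have hderiv : ContDiffOn ℝ (0 : ℕ) (mixedDeriv (fun j => hammingWeight b (k j)) f) (Icc 0 1) :=
    contDiffOn_mixedDeriv (by rwa [zero_add])
  rw [walshCoeff_eq_integral_mixedDeriv hb k hf]
  refine norm_integral_mul_le (integrableOn_unitCube hderiv.continuousOn) fun x => ?_
  rw [norm_prod]
  exact Finset.prod_le_prod (fun _ _ => norm_nonneg _) fun j _ => norm_walshKernel_le hb _ _

theorem kernelBound_nonneg {b : ℕ} (hb : 2 ≤ b) (k : ℕ) : 0 ≤ kernelBound b k :=
  (norm_nonneg _).trans (norm_walshKernel_le hb k 0)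

theorem prod_pow_mul_kernelBound (b : ℕ) {s : ℕ} (r : Fin s → ℝ) (k : Fin s → ℕ) :
    (∏ j, r j ^ hammingWeight b (k j)) * ∏ j, kernelBound b (k j)
      = (b : ℝ) ^ (-(muVec b k : ℤ)) * ∏ j, (r j * (mConst b)⁻¹) ^ hammingWeight b (k j) *
        CConst b ^ min 1 (hammingWeight b (k j)) := by
  rw [zpow_neg, zpow_natCast, muVec, ← Finset.prod_pow_eq_pow_sum, ← Finset.prod_inv_distrib,
    ← Finset.prod_mul_distrib, ← Finset.prod_mul_distrib]
  refine Finset.prod_congr rfl fun j _ => ?_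
  rw [kernelBound, mul_pow]
  ring

theorem norm_walshCoeff_le_of_L1norm_le {b : ℕ} [NeZero b] (hb : 2 ≤ b) {s : ℕ}
    {f : (Fin s → ℝ) → ℂ} (k : Fin s → ℕ)
    (hf : ContDiffOn ℝ (∑ j, hammingWeight b (k j) : ℕ) f (Icc 0 1)) {r : Fin s → ℝ}
    (hr : ∀ j, 0 ≤ r j) {D : ℝ} (hD : 0 ≤ D)
    (hL1 : L1norm (mixedDeriv (fun j => hammingWeight b (k j)) f)
      ≤ ENNReal.ofReal (D * ∏ j, r j ^ hammingWeight b (k j))) :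
    ‖walshCoeff b f k‖ ≤ D * (b : ℝ) ^ (-(muVec b k : ℤ)) *
      ∏ j, (r j * (mConst b)⁻¹) ^ hammingWeight b (k j) *
        CConst b ^ min 1 (hammingWeight b (k j)) := by
  have hnonneg : 0 ≤ D * ∏ j, r j ^ hammingWeight b (k j) :=
    mul_nonneg hD (Finset.prod_nonneg fun j _ => pow_nonneg (hr j) _)
  calc ‖walshCoeff b f k‖
      ≤ (L1norm (mixedDeriv (fun j => hammingWeight b (k j)) f)).toReal *
        ∏ j, kernelBound b (k j) := norm_walshCoeff_le hb k hf
    _ ≤ D * (∏ j, r j ^ hammingWeight b (k j)) * ∏ j, kernelBound b (k j) :=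
        mul_le_mul_of_nonneg_right (ENNReal.toReal_le_of_le_ofReal hnonneg hL1)
          (Finset.prod_nonneg fun j _ => kernelBound_nonneg hb (k j))
    _ = _ := by rw [mul_assoc, prod_pow_mul_kernelBound, ← mul_assoc]

theorem CConst_pow_min_one_le {b : ℕ} (hb : 2 ≤ b) (v : ℕ) :
    CConst b ^ min 1 v ≤ max 1 (CConst b) := by
  calc CConst b ^ min 1 v ≤ max 1 (CConst b) ^ min 1 v :=
        pow_le_pow_left₀ (CConst_nonneg hb) (le_max_right _ _) _
    _ ≤ max 1 (CConst b) ^ 1 := pow_le_pow_right₀ (le_max_left _ _) (min_le_left _ _)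
    _ = max 1 (CConst b) := pow_one _

end WalshDecay

end

theorem mainTheorem10 (b : ℕ) [NeZero b] (hb : 2 ≤ b) (s : ℕ) (f : (Fin s → ℝ) → ℂ)
    (hf : ContDiffOn ℝ ∞ f (Set.Icc 0 1)) (r : Fin s → ℝ) (hr : ∀ j, 0 < r j)
    (D : ℝ) (hD : 0 < D)
    (hbound : ∀ n : Fin s → ℕ,
      WalshDecay.L1norm (WalshDecay.mixedDeriv n f) ≤ ENNReal.ofReal (D * ∏ j, r j ^ n j)) :
    (∀ k : Fin s → ℕ,
      ‖WalshDecay.walshCoeff b f k‖ ≤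
        D * (b : ℝ) ^ (-(WalshDecay.muVec b k : ℤ)) *
          ∏ j, (r j * (WalshDecay.mConst b)⁻¹) ^ WalshDecay.hammingWeight b (k j) *
            WalshDecay.CConst b ^ min 1 (WalshDecay.hammingWeight b (k j))) ∧
    ((∀ j, r j = WalshDecay.mConst b) →
      Asymptotics.IsBigO ⊤ (fun k : Fin s → ℕ => WalshDecay.walshCoeff b f k)
        (fun k : Fin s → ℕ => (b : ℝ) ^ (-(WalshDecay.muVec b k : ℤ)))) := by
  have hcoeff (k : Fin s → ℕ) := WalshDecay.norm_walshCoeff_le_of_L1norm_le hb k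
    (hf.of_le (by exact_mod_cast le_top)) (fun j => (hr j).le) hD.le (hbound _)
  refine ⟨hcoeff, fun hrm => ?_⟩
  refine .of_bound (D * ∏ _j : Fin s, max 1 (WalshDecay.CConst b)) (.of_forall fun k => ?_)
  refine (hcoeff k).trans ?_
  rw [Real.norm_of_nonneg (by positivity), mul_right_comm]
  simp only [hrm, mul_inv_cancel₀ (WalshDecay.mConst_pos hb).ne', one_pow, one_mul]
  gcongr with j
  · exact fun j _ => pow_nonneg (WalshDecay.CConst_nonneg hb) _
  · exact WalshDecay.CConst_pow_min_one_le hb _
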